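/- **Setting.** Let $T$ be a complete first-order theory with infinite models in a language $\mathcal L$, and let $\mathfrak C\models T$ be a monster model, i.e. $\mathfrak C$ is $\kappa$-saturated and strongly $\kappa$-homogeneous; "small" and "short" mean of size, resp. length, less than $\kappa$. Let $M\preceq\mathfrak C$ be a small elementary submodel, $\bar m$ an enumeration of $M$, and $\bar x,\bar y$ tuples of variables corresponding to $\bar m$. Let $\mathfrak C'\succeq\mathfrak C$ be a larger monster model in which $\mathfrak C$ is small. No NIP assumption is made. A (global) Keisler measure in $\bar y$ is a finitely additive probability measure $\mu$ on the $\mathfrak C$-definable subsets of $\mathfrak C^{\bar y}$; it is identified with the corresponding regular Borel probability measure on the type space $S_{\bar y}(\mathfrak C)$. Let $\mathfrak M_{\bar y}(\mathfrak C)$ be the set of all of them, and $\mathfrak M_{\bar m}(\mathfrak C)$ the set of those with $\mu(S_{\bar m}(\mathfrak C))=1$, where $S_{\bar m}(\mathfrak C)\subseteq S_{\bar y}(\mathfrak C)$ is the closed set of types extending $\mathrm{tp}(\bar m/\emptyset)$. The measure $\mu$ is $M$-invariant if $\mu(\varphi(\bar b;\bar y))=\mu(\varphi(\bar b';\bar y))$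 for every $\mathcal L$-formula $\varphi(\bar z;\bar y)$ and all short tuples $\bar b\equiv_M\bar b'$ from $\mathfrak C^{\bar z}$. Write $\mathfrak M^{\mathrm{inv}}_{\bar y}(\mathfrak C,M)$ and $\mathfrak M^{\mathrm{inv}}_{\bar m}(\mathfrak C,M)$ for the sets of $M$-invariant measures in $\mathfrak M_{\bar y}(\mathfrak C)$ and $\mathfrak M_{\bar m}(\mathfrak C)$. For $M$-invariant $\mu$ let $F_\mu^{\varphi}:S_{\bar z}(M)\to[0,1]$, $F_\mu^\varphi(q)=\mu(\varphi(\bar b;\bar y))$ for any $\bar b\models q$ in $\mathfrak C$; $\mu$ is Borel-definable (definable) over $M$ if all the maps $F_\mu^\varphi$ are Borel (continuous). For $\bar b\in\mathfrak C^{\bar x}$ let $h_{\bar b}:S_{\bar m}(\mathfrak C)\to S_{\bar x}(M)$, $\mathrm{tp}(\sigma(\bar m)/\mathfrak C)\mapsto\mathrm{tp}(\sigma^{-1}(\bar b)/M)$ for $\sigma\in\mathrm{Aut}(\mathfrak C')$. For $\mu\in\mathfrak M^{\mathrm{inv}}_{\bar y}(\mathfrak C,M)$ Borel-definable over $M$ and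 $\nu\in\mathfrak M_{\bar m}(\mathfrak C)$, the convolution product $\mu\ast\nu\in\mathfrak M_{\bar y}(\mathfrak C)$ is the Keisler measure given by $$(\mu\ast\nu)(\varphi(\bar b;\bar y))=\int_{S_{\bar x}(M)}F_\mu^{\varphi}\,d(h_{\bar b})_*(\nu)\qquad\text{for all }\mathcal L\text{-formulas }\varphi(\bar x;\bar y)\text{ and all }\bar b\in\mathfrak C^{\bar x}.$$ **Theorem.** Let $\nu,\lambda\in\mathfrak M^{\mathrm{inv}}_{\bar m}(\mathfrak C,M)$, where $\nu$ is Borel-definable over $M$, and let $\mu\in\mathfrak M^{\mathrm{inv}}_{\bar y}(\mathfrak C,M)$ be definable over $M$. Then $\mu\ast\nu$ is a well-defined Keisler measure that is $M$-invariant and Borel-definable over $M$, $\nu\ast\lambda$ is a well-defined Keisler measure in $\mathfrak M^{\mathrm{inv}}_{\bar m}(\mathfrak C,M)$, the products $(\mu\ast\nu)\ast\lambda$ and $\mu\ast(\nu\ast\lambda)$ are well-defined Keisler measures, and $$(\mu\ast\nu)\ast\lambda=\mu\ast(\nu\ast\lambda).$$ -/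

import Mathlib

open FirstOrder FirstOrder.Language MeasureTheory Cardinal

universe u v w w' x

noncomputable section

namespace KeislerConvolution

/-! ### Monster models -/

/-- `N` is `κ`-saturated: over every parameter set of size `< κ`, every finitely satisfiable set of
formulas in one variable is realized in `N`. -/
def IsSaturated (L : FirstOrder.Language.{u, v}) (N : Type w) [L.Structure N] (κ : Cardinal.{w}) : Prop :=
  ∀ A : Set N, #A < κ → ∀ Γ : Set (L.Formula (A ⊕ Unit)),
    (∀ Γ₀ : Finset (L.Formula (A ⊕ Unit)), (Γ₀ : Set (L.Formula (A ⊕ Unit))) ⊆ Γ →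
      ∃ a : N, ∀ φ ∈ Γ₀, φ.Realize (Sum.elim Subtype.val fun _ => a)) →
    ∃ a : N, ∀ φ ∈ Γ, φ.Realize (Sum.elim Subtype.val fun _ => a)

/-- `N` is strongly `κ`-homogeneous: every elementary map between subsets of size `< κ` extends to
an automorphism of `N`. -/
def IsStronglyHomogeneous (L : FirstOrder.Language.{u, v}) (N : Type w) [L.Structure N]
    (κ : Cardinal.{w}) : Prop :=
  ∀ A : Set N, #A < κ → ∀ f : A → N,
    (∀ φ : L.Formula A, φ.Realize Subtype.val ↔ φ.Realize f) →
    ∃ σ : N ≃[L] N, ∀ a : A, σ a = f a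

/-- `N` is a monster model (of its complete theory) with respect to the cardinal `κ`. -/
structure IsMonster (L : FirstOrder.Language.{u, v}) (N : Type w) [L.Structure N]
    (κ : Cardinal.{w}) : Prop where
  saturated : IsSaturated L N κ
  homogeneous : IsStronglyHomogeneous L N κ

/-! ### Type spaces -/

section Types

variable {L : FirstOrder.Language.{u, v}} {C : Type w} [L.Structure C] {A : Set C} {ι : Type x}

/-- The space `S_ι(A)` of complete types over `A ⊆ C` in variables indexed by `ι`, with Mathlib's
topology, whose basic clopen sets are given by formulas over `A`. -/
abbrev TypeSpace (L : FirstOrder.Language.{u, v}) (C : Type w) [L.Structure C] (A : Set C) (ι : Type x) :=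
  (L[[A]].completeTheory C).CompleteType ι

/-- Type spaces carry their Borel σ-algebra. -/
instance : MeasurableSpace (TypeSpace L C A ι) := borel _

instance : BorelSpace (TypeSpace L C A ι) := ⟨rfl⟩

/-- The formula `φ(ι)` with parameters from `A` belongs to the type `p`. -/
def Contains (p : TypeSpace L C A ι) (φ : L.Formula (A ⊕ ι)) : Prop :=
  Formula.equivSentence (BoundedFormula.constantsVarsEquiv.symm φ : L[[A]].Formula ι) ∈ p

/-- The tuple `a` of elements of `N` realizes `p`, that is `tp(a/A) = p`, where the parameters
from `A ⊆ C` are interpreted in `N` along the (elementary) map `e : C → N`. -/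
def Realizes {N : Type w'} [L.Structure N] (e : C → N) (a : ι → N) (p : TypeSpace L C A ι) : Prop :=
  ∀ φ : L.Formula (A ⊕ ι), Contains p φ ↔ φ.Realize (Sum.elim (fun c => e c) a)

/-- The closed subspace `S_m(C)` of the global types that extend `tp(m/∅)`. -/
def typesExtending (L : FirstOrder.Language.{u, v}) [L.Structure C] (m : ι → C) :
    Set (TypeSpace L C Set.univ ι) :=
  {p | ∀ φ : L.Formula ι, φ.Realize m → Contains p (φ.relabel Sum.inr)}

/-- `a ≡_A b`. -/
def SameType (L : FirstOrder.Language.{u, v}) [L.Structure C] (A : Set C) (a b : ι → C) : Prop :=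
  ∀ φ : L.Formula (A ⊕ ι),
    φ.Realize (Sum.elim Subtype.val a) ↔ φ.Realize (Sum.elim Subtype.val b)

end Types

/-! ### Keisler measures -/

section Measures

variable {L : FirstOrder.Language.{u, v}} {C : Type w} [L.Structure C] {A : Set C} {ι : Type x}

/-- The `A`-definable set of solutions of a formula with parameters from `A`. -/
def solutionSet (φ : L.Formula (A ⊕ ι)) : L.DefinableSet A ι :=
  ⟨{a | φ.Realize (Sum.elim Subtype.val a)}, Set.definable_iff_exists_formula_sum.2 ⟨φ, rfl⟩⟩

/-- The definable set `φ(b; C)`: here `b` is substituted for the first block of variables. -/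
def fiber {β : Type*} (φ : L.Formula (β ⊕ ι)) (b : β → C) : L.DefinableSet (Set.univ : Set C) ι :=
  solutionSet (φ.relabel (Sum.map (fun i => ⟨b i, Set.mem_univ (b i)⟩) id))

theorem mem_fiber {β : Type*} (φ : L.Formula (β ⊕ ι)) (b : β → C) (a : ι → C) :
    a ∈ fiber φ b ↔ φ.Realize (Sum.elim b a) := by
  change (φ.relabel _).Realize _ ↔ _
  rw [Formula.realize_relabel]
  refine iff_of_eq (congrArg φ.Realize ?_)
  funext i
  rcases i with i | i <;> rfl

/-- A Keisler measure over `A` in variables indexed by `ι`: a finitely additive probability measure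
on the `A`-definable subsets of `C ^ ι`. -/
structure KeislerMeasure (L : FirstOrder.Language.{u, v}) (C : Type w) [L.Structure C] (A : Set C)
    (ι : Type x) where
  toFun : L.DefinableSet A ι → ℝ
  nonneg : ∀ s, 0 ≤ toFun s
  top_eq_one : toFun ⊤ = 1
  additive : ∀ s t, Disjoint s t → toFun (s ⊔ t) = toFun s + toFun t

instance : CoeFun (KeislerMeasure L C A ι) fun _ => L.DefinableSet A ι → ℝ := ⟨fun μ => μ.toFun⟩

/-- Keisler measures in the variables `ι` over all of `C`. -/
abbrev GlobalMeasure (L : FirstOrder.Language.{u, v}) (C : Type w) [L.Structure C] (ι : Type x) :=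
  KeislerMeasure L C Set.univ ι

open Classical in
instance [Nonempty C] : Nonempty (KeislerMeasure L C A ι) := by
  let a : ι → C := fun _ => Classical.arbitrary C
  refine ⟨⟨fun s => if a ∈ s then 1 else 0, fun s => by split_ifs <;> norm_num,
    if_pos (DefinableSet.mem_top), fun s t h => ?_⟩⟩
  have h' : ¬ (a ∈ s ∧ a ∈ t) := fun hst => by
    have : a ∈ s ⊓ t := DefinableSet.mem_inf.2 hst
    rw [h.eq_bot] at this
    exact DefinableSet.notMem_bot this
  by_cases hs : a ∈ s <;> by_cases ht : a ∈ t <;> simp_all [DefinableSet.mem_sup]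

/-- `η` is a regular Borel measure on the type space that agrees with `μ` on formulas. -/
def IsBorelExtension (μ : KeislerMeasure L C A ι) (η : Measure (TypeSpace L C A ι)) : Prop :=
  η.Regular ∧ ∀ φ : L.Formula (A ⊕ ι), η {p | Contains p φ} = ENNReal.ofReal (μ (solutionSet φ))

/-- The (unique) regular Borel probability measure on the type space that corresponds to `μ`. -/
def borelMeasure (μ : KeislerMeasure L C A ι) : Measure (TypeSpace L C A ι) :=
  Classical.epsilon (IsBorelExtension μ)

/-- `μ ∈ 𝔐_m(C)`: the global measure `μ` concentrates on `tp(m/∅)`. -/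
def ConcentratesOn (m : ι → C) (μ : GlobalMeasure L C ι) : Prop :=
  borelMeasure μ (typesExtending L m) = 1

/-- `μ` is `M`-invariant: `μ(φ(b; y)) = μ(φ(b'; y))` whenever `b ≡_M b'` are short tuples. -/
def IsInvariantOver (κ : Cardinal.{w}) (M : L.ElementarySubstructure C)
    (μ : GlobalMeasure L C ι) : Prop :=
  ∀ β : Type w, #β < κ → ∀ (φ : L.Formula (β ⊕ ι)) (b b' : β → C),
    SameType L (M : Set C) b b' → μ (fiber φ b) = μ (fiber φ b')

/-- The map `F_{μ,M}^φ : S_β(M) → [0,1]`, sending `q` to `μ(φ(b; y))` for any `b ∈ C ^ β`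
realizing `q`. -/
def fiberMap [Nonempty C] {β : Type*} (M : L.ElementarySubstructure C) (μ : GlobalMeasure L C ι)
    (φ : L.Formula (β ⊕ ι)) (q : TypeSpace L C (M : Set C) β) : ℝ :=
  μ (fiber φ (Classical.epsilon fun b : β → C => Realizes id b q))

/-- `μ` is `M`-invariant and Borel-definable over `M`. -/
structure IsBorelDefinable [Nonempty C] (κ : Cardinal.{w}) (M : L.ElementarySubstructure C)
    (μ : GlobalMeasure L C ι) : Prop where
  invariant : IsInvariantOver κ M μ
  measurable : ∀ β : Type w, #β < κ → ∀ φ : L.Formula (β ⊕ ι), Measurable (fiberMap M μ φ)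

/-- `μ` is `M`-invariant and definable over `M`. -/
structure IsDefinable [Nonempty C] (κ : Cardinal.{w}) (M : L.ElementarySubstructure C)
    (μ : GlobalMeasure L C ι) : Prop where
  invariant : IsInvariantOver κ M μ
  continuous : ∀ β : Type w, #β < κ → ∀ φ : L.Formula (β ⊕ ι), Continuous (fiberMap M μ φ)

/-- The value `(μ ⊗ η)(φ(x; y)) = ∫_{S_x(M)} F_{μ,M}^φ dη` of the Morley product of the global
measure `μ` (in variables `y`) with a Borel measure `η` on `S_x(M)`. -/
def morleyProduct [Nonempty C] {β : Type*} (M : L.ElementarySubstructure C)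
    (μ : GlobalMeasure L C ι) (η : Measure (TypeSpace L C (M : Set C) β))
    (φ : L.Formula (β ⊕ ι)) : ℝ :=
  ∫ q, fiberMap M μ φ q ∂η

end Measures

/-! ### The convolution product -/

section Convolution

variable {L : FirstOrder.Language.{u, v}} {C : Type w} [L.Structure C] [Nonempty C]
  {C' : Type w'} [L.Structure C'] {M : L.ElementarySubstructure C} {ι : Type w}

/-- The tuple `m` of elements of `C` underlying an enumeration of `M`. -/
def tuple (m : ι ≃ M) : ι → C := fun i => (m i : C)

instance (A : Set C) : Nonempty (TypeSpace L C A ι) :=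
  ⟨Theory.typeOf _ fun _ => Classical.arbitrary C⟩

/-- The map `h_b : S_m(C) → S_x(M)`, `tp(σ(m)/C) ↦ tp(σ⁻¹(b)/M)` for `σ ∈ Aut(C')`, where `C'` is a
larger monster model, containing `C` via `j`. -/
def hMap (j : C ↪ₑ[L] C') (m : ι ≃ M) (b : ι → C) (p : typesExtending L (tuple m)) :
    TypeSpace L C (M : Set C) ι :=
  Classical.epsilon fun q => ∃ σ : C' ≃[L] C',
    Realizes j (fun i => σ (j (tuple m i))) p.1 ∧ Realizes j (fun i => σ.symm (j (b i))) q

/-- The measure `(h_b)_*(ν)` on `S_x(M)`, for `ν ∈ 𝔐_m(C)` viewed as a Borel measure on `S_m(C)`. -/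
def hPush (j : C ↪ₑ[L] C') (m : ι ≃ M) (b : ι → C) (ν : GlobalMeasure L C ι) :
    Measure (TypeSpace L C (M : Set C) ι) :=
  ((borelMeasure ν).comap (Subtype.val : typesExtending L (tuple m) → _)).map (hMap j m b)

/-- `ρ` is the convolution product of `μ` and `ν`: for all `b ∈ C ^ x` and all `L`-formulas
`φ(x; y)`, `ρ(φ(b; y)) = (μ_y ⊗ ((h_b)_* ν)_x)(φ(x; y))`. -/
def IsConvolution (j : C ↪ₑ[L] C') (m : ι ≃ M) (μ ν ρ : GlobalMeasure L C ι) : Prop :=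
  ∀ (b : ι → C) (φ : L.Formula (ι ⊕ ι)), ρ (fiber φ b) = morleyProduct M μ (hPush j m b ν) φ

/-- The convolution product `μ ∗ ν`, i.e. the Keisler measure given by the formula in
`IsConvolution`. -/
def starProduct (j : C ↪ₑ[L] C') (m : ι ≃ M) (μ ν : GlobalMeasure L C ι) : GlobalMeasure L C ι :=
  Classical.epsilon (IsConvolution j m μ ν)

end Convolution

end KeislerConvolution

end

open KeislerConvolution

/-!
For `p = tp(σ(m)/C)` the type `h_b(p) = tp(σ⁻¹(b)/M)` can be read off from `p` syntactically:
`φ(x; m) ∈ h_b(p)` if and only if `φ(b; y) ∈ p`. So `h_b` makes sense, and is continuous, for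
tuples `b` of any length, and `σ⁻¹(b)` has the same type over `∅` as `b`. If `μ` is `M`-invariant,
then `φ(b; C) ↦ F_μ^φ(h_b(p))` is therefore a Keisler measure, the conjugate of `μ` by `σ`, and
`μ ∗ ν` is the mean of these conjugates with respect to `ν`.

The same syntactic description gives `((h_b)_* ν)[θ] = F_ν^θ*(tp(b/M))`, where `θ(x) = θ*(x; m)`.
Two consequences for clopen sets `U` of types over `M`: the function `tp(c/M) ↦ ((h_c)_* ν)(U)` is
Borel, and `((h_b)_* (ν ∗ λ))(U)` is its integral with respect to `(h_b)_* λ`. Continuous functions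
on a profinite space are uniform limits of linear combinations of indicators of clopen sets, so
both facts pass from `U` to the function `F_μ^φ`, which is continuous because `μ` is definable. The
first then says that `F_{μ∗ν}^φ(tp(c/M)) = ∫ F_μ^φ d(h_c)_*ν` is Borel, and the second is
associativity.
-/

namespace KeislerConvolution

section FinitelyAdditive

variable {B R : Type*} [GeneralizedBooleanAlgebra B] [AddCommMonoid R] [PartialOrder R]
  [IsOrderedAddMonoid R] {f : B → R}

theorem monotone_of_additive (h0 : ∀ a, 0 ≤ f a)
    (hf : ∀ a b, Disjoint a b → f (a ⊔ b) = f a + f b) : Monotone f := fun a b h => by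
  rw [← sup_sdiff_cancel_right h, hf _ _ disjoint_sdiff_self_right]
  exact le_add_of_nonneg_right (h0 _)

theorem sup_le_add_of_additive (h0 : ∀ a, 0 ≤ f a)
    (hf : ∀ a b, Disjoint a b → f (a ⊔ b) = f a + f b) (a b : B) : f (a ⊔ b) ≤ f a + f b := by
  rw [← sup_sdiff_self_right, hf _ _ disjoint_sdiff_self_right]
  exact add_le_add le_rfl (monotone_of_additive h0 hf sdiff_le)

end FinitelyAdditive

section Profinite

open TopologicalSpace
open scoped NNReal

variable {X : Type*} [TopologicalSpace X]

/-- The outer approximation of a function on clopen sets: the infimum of its values on the clopen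
sets containing `K`. -/
noncomputable def outerClopen (f : Clopens X → ℝ≥0) (K : Set X) : ℝ≥0 :=
  ⨅ U : {U : Clopens X // K ⊆ U}, f U

instance (K : Set X) : Nonempty {U : Clopens X // K ⊆ U} := ⟨⟨⊤, Set.subset_univ K⟩⟩

variable {f : Clopens X → ℝ≥0} {K K₁ K₂ : Set X}

theorem outerClopen_le {U : Clopens X} (h : K ⊆ U) : outerClopen f K ≤ f U :=
  ciInf_le (OrderBot.bddBelow _) (⟨U, h⟩ : {U : Clopens X // K ⊆ U})

theorem outerClopen_mono (h : K₁ ⊆ K₂) : outerClopen f K₁ ≤ outerClopen f K₂ :=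
  le_ciInf fun U => outerClopen_le (h.trans U.2)

theorem outerClopen_clopen (hf : Monotone f) (U : Clopens X) : outerClopen f U = f U :=
  le_antisymm (outerClopen_le subset_rfl) (le_ciInf fun V => hf V.2)

theorem outerClopen_union_le (hf : ∀ U V, f (U ⊔ V) ≤ f U + f V) :
    outerClopen f (K₁ ∪ K₂) ≤ outerClopen f K₁ + outerClopen f K₂ :=
  NNReal.le_iInf_add_iInf fun U V =>
    (outerClopen_le (Set.union_subset_union U.2 V.2)).trans (hf U V)

variable [CompactSpace X] [TotallySeparatedSpace X]

theorem outerClopen_add_le (hf : ∀ U V, Disjoint U V → f (U ⊔ V) = f U + f V)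
    (hK : Disjoint K₁ K₂) (h₁ : IsClosed K₁) (h₂ : IsClosed K₂) :
    outerClopen f K₁ + outerClopen f K₂ ≤ outerClopen f (K₁ ∪ K₂) := by
  obtain ⟨V, hV, hKV, hVK⟩ :=
    exists_clopen_of_closed_subset_open h₁ h₂.isOpen_compl hK.subset_compl_right
  refine le_ciInf fun W => ?_
  rw [← sup_inf_sdiff W.1 ⟨V, hV⟩, hf _ _ disjoint_inf_sdiff]
  obtain ⟨hKW₁, hKW₂⟩ := Set.union_subset_iff.1 W.2
  exact add_le_add (outerClopen_le (Set.subset_inter hKW₁ hKV))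
    (outerClopen_le fun x hx => ⟨hKW₂ hx, fun hxV => hVK hxV hx⟩)

theorem exists_regular_measure_of_additive [MeasurableSpace X] [BorelSpace X] (f : Clopens X → ℝ≥0)
    (hf : ∀ U V, Disjoint U V → f (U ⊔ V) = f U + f V) :
    ∃ η : Measure X, η.Regular ∧ ∀ U : Clopens X, η U = f U := by
  let content : Content X :=
    { toFun K := outerClopen f K
      mono' _ _ := outerClopen_mono
      sup_le' _ _ := outerClopen_union_le (sup_le_add_of_additive (fun _ => zero_le) hf)
      sup_disjoint' K₁ K₂ hK h₁ h₂ := le_antisymm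
        (outerClopen_union_le (sup_le_add_of_additive (fun _ => zero_le) hf))
        (outerClopen_add_le hf hK h₁ h₂) }
  refine ⟨content.measure, inferInstance, fun U => ?_⟩
  rw [Content.measure_apply _ U.isClopen.isOpen.measurableSet,
    Content.outerMeasure_of_isOpen _ _ U.isClopen.isOpen,
    Content.innerContent_of_isCompact _ U.isClopen.isClosed.isCompact]
  exact congrArg _ (outerClopen_clopen (monotone_of_additive (fun _ => zero_le) hf) U)

theorem measure_le_of_isOpen_of_clopens_le [MeasurableSpace X] {η η' : Measure X} [η.Regular]
    (h : ∀ U : Set X, IsClopen U → η U ≤ η' U) {U : Set X} (hU : IsOpen U) : η U ≤ η' U := by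
  rw [hU.measure_eq_iSup_isCompact]
  refine iSup₂_le fun K hKU => iSup_le fun hK => ?_
  obtain ⟨V, hV, hKV, hVU⟩ := exists_clopen_of_closed_subset_open hK.isClosed hU hKU
  exact (measure_mono hKV).trans ((h V hV).trans (measure_mono hVU))

theorem regular_measure_ext_clopens [MeasurableSpace X] {η η' : Measure X} [η.Regular] [η'.Regular]
    (h : ∀ U : Set X, IsClopen U → η U = η' U) : η = η' :=
  Measure.OuterRegular.ext_isOpen fun _ hU => le_antisymm
    (measure_le_of_isOpen_of_clopens_le (fun V hV => (h V hV).le) hU)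
    (measure_le_of_isOpen_of_clopens_le (fun V hV => (h V hV).ge) hU)

theorem denseRange_toContinuousMap :
    DenseRange ((↑) : LocallyConstant X ℝ → C(X, ℝ)) := by
  have := ContinuousMap.subalgebra_topologicalClosure_eq_top_of_separatesPoints _
    (LocallyConstant.separatesPoints_range_toContinuousMapAlgHom (X := X) (Y := ℝ) ℝ)
  exact fun F => (this.ge : ⊤ ≤ _) (Algebra.mem_top (x := F))

end Profinite

section Mixture

open TopologicalSpace Filter Topology

variable {X Y : Type*} [TopologicalSpace X] [CompactSpace X] [MeasurableSpace X]

theorem norm_integral_continuousMap_le (η : Measure X) [IsProbabilityMeasure η] (F : C(X, ℝ)) :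
    ‖∫ x, F x ∂η‖ ≤ ‖F‖ := by
  simpa using norm_integral_le_of_norm_le_const (.of_forall F.norm_coe_le_norm) (μ := η)

variable [BorelSpace X]

theorem continuous_integral_continuousMap (η : Measure X) [IsFiniteMeasure η] :
    Continuous fun F : C(X, ℝ) => ∫ x, F x ∂η :=
  (continuous_integral.comp (ContinuousMap.toLp (E := ℝ) 1 η ℝ).continuous).congr fun F =>
    integral_congr_ae (ContinuousMap.coeFn_toLp η F)

theorem integral_locallyConstant (η : Measure X) [IsFiniteMeasure η] (f : LocallyConstant X ℝ) :
    ∫ x, f x ∂η = ∑ r ∈ f.range_finite.toFinset, η.real (f ⁻¹' {r}) * r :=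
  let s : SimpleFunc X ℝ :=
    ⟨f, fun r => (f.isLocallyConstant.isOpen_fiber r).measurableSet, f.range_finite⟩
  s.integral_eq_sum s.integrable_of_isFiniteMeasure

variable [TotallySeparatedSpace X] [MeasurableSpace Y]

/-
In the following lemmas `κ` need not be a `ProbabilityTheory.Kernel`: the clopen sets generate only
the Baire σ-algebra, which is in general smaller than the Borel σ-algebra.
-/
theorem measurable_integral_of_clopens {κ : Y → Measure X} [∀ y, IsFiniteMeasure (κ y)]
    (hκ : ∀ U : Set X, IsClopen U → Measurable fun y => (κ y).real U) (F : C(X, ℝ)) :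
    Measurable fun y => ∫ x, F x ∂κ y := by
  refine denseRange_toContinuousMap.induction_on
    (p := fun F : C(X, ℝ) => Measurable fun y => ∫ x, F x ∂κ y) F ?_ fun f => ?_
  · refine IsSeqClosed.isClosed fun F F₀ hF hlim => measurable_of_tendsto_metrizable hF ?_
    exact tendsto_pi_nhds.2 fun y =>
      ((continuous_integral_continuousMap (κ y)).tendsto F₀).comp hlim
  · simp only [LocallyConstant.coe_continuousMap, integral_locallyConstant]
    exact Finset.measurable_fun_sum _ fun r _ =>
      (hκ _ (f.isLocallyConstant.isClopen_fiber r)).mul_const r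

theorem continuous_integral_integral {κ : Y → Measure X} [∀ y, IsProbabilityMeasure (κ y)]
    (hκ : ∀ U : Set X, IsClopen U → Measurable fun y => (κ y).real U) (η : Measure Y)
    [IsFiniteMeasure η] : Continuous fun F : C(X, ℝ) => ∫ y, ∫ x, F x ∂κ y ∂η := by
  refine continuous_iff_continuousAt.2 fun F₀ => continuousAt_of_dominated
    (bound := fun _ => ‖F₀‖ + 1)
    (.of_forall fun F => (measurable_integral_of_clopens hκ F).aestronglyMeasurable) ?_
    (integrable_const _)
    (.of_forall fun y => (continuous_integral_continuousMap (κ y)).continuousAt)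
  filter_upwards [continuous_norm.continuousAt.eventually_lt_const (lt_add_one ‖F₀‖)] with F hF
  exact .of_forall fun y => (norm_integral_continuousMap_le (κ y) F).trans hF.le

theorem integral_eq_integral_integral_of_clopens {κ : Y → Measure X}
    [∀ y, IsProbabilityMeasure (κ y)] {η : Measure Y} [IsFiniteMeasure η] {ρ : Measure X}
    [IsFiniteMeasure ρ] (hκ : ∀ U : Set X, IsClopen U → Measurable fun y => (κ y).real U)
    (hρ : ∀ U : Set X, IsClopen U → ρ.real U = ∫ y, (κ y).real U ∂η) (F : C(X, ℝ)) :
    ∫ x, F x ∂ρ = ∫ y, ∫ x, F x ∂κ y ∂η := by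
  refine denseRange_toContinuousMap.induction_on
    (p := fun F : C(X, ℝ) => ∫ x, F x ∂ρ = ∫ y, ∫ x, F x ∂κ y ∂η) F
    (isClosed_eq (continuous_integral_continuousMap ρ) (continuous_integral_integral hκ η))
    fun f => ?_
  simp only [LocallyConstant.coe_continuousMap, integral_locallyConstant]
  have hf (r : ℝ) : IsClopen (f ⁻¹' {r}) := f.isLocallyConstant.isClopen_fiber r
  rw [integral_finsetSum _ fun r _ => ?_]
  · simp only [hρ _ (hf _), integral_mul_const]
  · have hle : ∀ y, ‖(κ y).real (f ⁻¹' {r})‖ ≤ 1 := fun y =>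
      (Real.norm_of_nonneg measureReal_nonneg).trans_le measureReal_le_one
    exact (Integrable.of_bound (hκ _ (hf r)).aestronglyMeasurable 1 (.of_forall hle)).mul_const r

end Mixture

theorem measure_iUnion_isOpen_null {X I : Type*} [TopologicalSpace X] [MeasurableSpace X]
    {η : Measure X} [η.Regular] {U : I → Set X} (hU : ∀ i, IsOpen (U i)) (h : ∀ i, η (U i) = 0) :
    η (⋃ i, U i) = 0 := by
  rw [(isOpen_iUnion hU).measure_eq_iSup_isCompact]
  simp only [ENNReal.iSup_eq_zero]
  intro K hKU hK
  obtain ⟨t, ht⟩ := hK.elim_finite_subcover U hU hKU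
  exact measure_mono_null ht ((measure_biUnion_null_iff t.countable_toSet).2 fun i _ => h i)

theorem regular_map_comap_subtype {X Y : Type*} [TopologicalSpace X] [T2Space X]
    [MeasurableSpace X] [BorelSpace X] [TopologicalSpace Y] [R1Space Y] [MeasurableSpace Y]
    [BorelSpace Y] (η : Measure X) [η.Regular] [IsFiniteMeasure η] {S : Set X} (hS : IsClosed S)
    {f : S → Y} (hf : Continuous f) : ((η.comap Subtype.val).map f).Regular := by
  have hval := MeasurableEmbedding.subtype_coe hS.measurableSet
  have : IsFiniteMeasure (η.comap (Subtype.val : S → X)) :=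
    ⟨by rw [hval.comap_apply]; exact measure_lt_top _ _⟩
  have : (η.comap (Subtype.val : S → X)).InnerRegularCompactLTTop :=
    ⟨Measure.InnerRegularCompactLTTop.innerRegular.comap hval
      (fun U hU => ⟨hval.measurableSet_image.2 hU.1, measure_ne_top _ _⟩)
      fun K _ hK => hS.isClosedEmbedding_subtypeVal.isCompact_preimage hK⟩
  have := Measure.InnerRegularCompactLTTop.map_of_continuous (μ := η.comap (Subtype.val : S → X)) hf
  infer_instance

section Tuples

variable {L : FirstOrder.Language.{u, v}} {N N' : Type*} [L.Structure N] [L.Structure N']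
  {α β : Type*}

/-- The tuples `a` of `N` and `a'` of `N'` have the same type over `∅`. The parameters of a type
over a set are treated as part of the tuple, so that this also expresses equality of types over
parameters and elementarity of partial maps. -/
def TupleEquiv (L : FirstOrder.Language.{u, v}) {N N' : Type*} [L.Structure N] [L.Structure N']
    (a : α → N) (a' : α → N') : Prop :=
  ∀ φ : L.Formula α, φ.Realize a ↔ φ.Realize a'

theorem TupleEquiv.of_imp {a : α → N} {a' : α → N'}
    (h : ∀ φ : L.Formula α, φ.Realize a → φ.Realize a') : TupleEquiv L a a' := fun φ =>
  ⟨h φ, fun hφ => by_contra fun h' => h φ.not h' hφ⟩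

theorem TupleEquiv.symm {a : α → N} {a' : α → N'} (h : TupleEquiv L a a') : TupleEquiv L a' a :=
  fun φ => (h φ).symm

theorem TupleEquiv.comp {a : α → N} {a' : α → N'} (h : TupleEquiv L a a') (f : β → α) :
    TupleEquiv L (a ∘ f) (a' ∘ f) := fun φ => by
  simpa only [Formula.realize_relabel] using h (φ.relabel f)

theorem TupleEquiv.trans {N'' : Type*} [L.Structure N''] {a : α → N} {a' : α → N'} {a'' : α → N''}
    (h : TupleEquiv L a a') (h' : TupleEquiv L a' a'') : TupleEquiv L a a'' := fun φ =>
  (h φ).trans (h' φ)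

theorem tupleEquiv_embedding (j : N ↪ₑ[L] N') (a : α → N) : TupleEquiv L a (j ∘ a) := fun φ =>
  (j.map_formula φ a).symm

theorem tupleEquiv_of_finset {a : α → N} {a' : α → N'}
    (h : ∀ s : Finset α, TupleEquiv L (fun i : s => a i) fun i : s => a' i) :
    TupleEquiv L a a' := fun φ => by
  classical
  have hN := BoundedFormula.realize_restrictFreeVar' (φ := φ) subset_rfl (v := a) (xs := default)
  have hN' := BoundedFormula.realize_restrictFreeVar' (φ := φ) subset_rfl (v := a') (xs := default)
  exact hN.symm.trans ((h φ.freeVarFinset _).trans hN')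

theorem TupleEquiv.eq_iff {a : α → N} {a' : α → N'} (h : TupleEquiv L a a') (i k : α) :
    a i = a k ↔ a' i = a' k := by
  simpa [Formula.realize_equal] using h (Term.equal (var i) (var k))

theorem TupleEquiv.exists_range_extension {a : α → N} {a' : α → N'} (h : TupleEquiv L a a') :
    ∃ f : Set.range a → N', TupleEquiv L Subtype.val f ∧ ∀ i, f ⟨a i, i, rfl⟩ = a' i := by
  have hs : ∀ x : Set.range a, a (Classical.choose x.2) = x := fun x => Classical.choose_spec x.2
  refine ⟨fun x => a' (Classical.choose x.2), ?_, fun i => (h.eq_iff _ _).1 (hs ⟨a i, i, rfl⟩)⟩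
  have := h.comp fun x : Set.range a => Classical.choose x.2
  rwa [show a ∘ _ = Subtype.val from funext hs] at this

open Classical in
/-- The formula `∃ y, ψ(x; y)`, where all the variables `y` in the right summand are quantified;
only finitely many of them occur in `ψ`. -/
noncomputable def exRight (ψ : L.Formula (α ⊕ β)) : L.Formula α :=
  Formula.iExs ψ.freeVarFinset
    (ψ.restrictFreeVar fun z => z.1.elim Sum.inl fun _ => Sum.inr z)

theorem realize_exRight [Nonempty N] (ψ : L.Formula (α ⊕ β)) (v : α → N) :
    (exRight ψ).Realize v ↔ ∃ b : β → N, ψ.Realize (Sum.elim v b) := by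
  classical
  rw [exRight, Formula.realize_iExs]
  constructor
  · rintro ⟨b, hb⟩
    refine ⟨fun i => if h : Sum.inr i ∈ ψ.freeVarFinset then b ⟨Sum.inr i, h⟩ else
      Classical.arbitrary N, (BoundedFormula.realize_restrictFreeVar _ ?_).1 hb⟩
    rintro ⟨i | i, h⟩
    · rfl
    · simp [h]
  · rintro ⟨b, hb⟩
    refine ⟨fun z => Sum.elim v b z, (BoundedFormula.realize_restrictFreeVar _ ?_).2 hb⟩
    rintro ⟨i | i, h⟩ <;> rfl

theorem TupleEquiv.exists_realize [Nonempty N] [Nonempty N'] {e : α → N} {e' : α → N'}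
    (h : TupleEquiv L e e') {ψ : L.Formula (α ⊕ β)} {b : β → N} (hb : ψ.Realize (Sum.elim e b)) :
    ∃ b' : β → N', ψ.Realize (Sum.elim e' b') :=
  (realize_exRight ψ e').1 ((h _).1 ((realize_exRight ψ e).2 ⟨b, hb⟩))

end Tuples

section Saturation

variable {L : FirstOrder.Language.{u, v}} {N : Type w} [L.Structure N]
  {N' : Type*} [L.Structure N'] {κ : Cardinal.{w}} {α : Type*} {β : Type x}

theorem IsSaturated.exists_tupleEquiv_subtype [Nonempty N] (hN : IsSaturated L N κ) {A : Set N}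
    (hA : #A < κ) {f : A → N'} (h : TupleEquiv L Subtype.val f) (c' : N') :
    ∃ c : N, TupleEquiv L (Sum.elim (Subtype.val : A → N) fun _ : Unit => c)
      (Sum.elim f fun _ => c') := by
  have : Nonempty N' := ⟨c'⟩
  obtain ⟨c, hc⟩ := hN A hA {φ | φ.Realize (Sum.elim f fun _ => c')} fun Γ₀ hΓ₀ => by
    have hinf : (Formula.iInf fun φ : Γ₀ => φ.1).Realize (Sum.elim f fun _ : Unit => c') :=
      Formula.realize_iInf.2 fun φ => hΓ₀ φ.2
    obtain ⟨b, hb⟩ := h.symm.exists_realize hinf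
    exact ⟨b (), fun φ hφ => Formula.realize_iInf.1 hb ⟨φ, hφ⟩⟩
  exact ⟨c, TupleEquiv.symm (.of_imp hc)⟩

theorem IsSaturated.exists_tupleEquiv_unit [Nonempty N] (hN : IsSaturated L N κ) {e : α → N}
    {e' : α → N'} (he : #(Set.range e) < κ) (h : TupleEquiv L e e') (c' : N') :
    ∃ c : N, TupleEquiv L (Sum.elim e fun _ : Unit => c) (Sum.elim e' fun _ => c') := by
  obtain ⟨f, hf, hfe⟩ := h.exists_range_extension
  obtain ⟨c, hc⟩ := hN.exists_tupleEquiv_subtype he hf c'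
  refine ⟨c, ?_⟩
  have := hc.comp (Sum.map (Set.rangeFactorization e) id)
  simp only [Sum.elim_comp_map] at this
  rwa [show f ∘ Set.rangeFactorization e = e' from funext hfe] at this

theorem TupleEquiv.sumElim_of_forall_Iic [LinearOrder β] {e : α → N} {e' : α → N'}
    (h : TupleEquiv L e e') {b : β → N} {b' : β → N'} {s : Set β}
    (hs : ∀ i ∈ s, TupleEquiv L (Sum.elim e fun k : Set.Iic i => b k)
      (Sum.elim e' fun k : Set.Iic i => b' k)) :
    TupleEquiv L (Sum.elim e fun k : s => b k) (Sum.elim e' fun k : s => b' k) := by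
  refine tupleEquiv_of_finset fun t => ?_
  obtain ⟨r, hr, htr⟩ : ∃ r : Set β,
      TupleEquiv L (Sum.elim e fun k : r => b k) (Sum.elim e' fun k : r => b' k) ∧
        ∀ k, Sum.inr k ∈ t → (k : β) ∈ r := by
    rcases t.toRight.eq_empty_or_nonempty with ht | ht
    · refine ⟨∅, ?_, fun k hk => by simp [← Finset.mem_toRight, ht] at hk⟩
      convert h.comp (Sum.elim id fun k : (∅ : Set β) => k.2.elim) using 1 <;>
        exact funext fun | .inl _ => rfl | .inr k => k.2.elim
    · exact ⟨Set.Iic (t.toRight.max' ht), hs _ (Subtype.prop _), fun k hk =>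
        t.toRight.le_max' k (Finset.mem_toRight.2 hk)⟩
  let g : t → α ⊕ r := fun
    | ⟨.inl i, _⟩ => .inl i
    | ⟨.inr k, hk⟩ => .inr ⟨k, htr k hk⟩
  convert hr.comp g using 1 <;> exact funext fun | ⟨.inl _, _⟩ => rfl | ⟨.inr _, _⟩ => rfl

open Classical in
/-- A tuple of `N` built by recursion along a well-order, choosing at each step an element that
keeps the types of the initial segments equal to those of `b'`, as long as this is possible. -/
noncomputable def matchingTuple (L : FirstOrder.Language.{u, v}) {N : Type*} [L.Structure N]
    [Nonempty N] {N' : Type*} [L.Structure N'] [LinearOrder β] [WellFoundedLT β] (e : α → N)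
    (e' : α → N') (b' : β → N') : β → N :=
  wellFounded_lt.fix fun i b => Classical.epsilon fun c =>
    TupleEquiv L (Sum.elim (Sum.elim e fun k : Set.Iio i => b k k.2) fun _ : Unit => c)
      (Sum.elim (Sum.elim e' fun k : Set.Iio i => b' k) fun _ => b' i)

theorem matchingTuple_eq [Nonempty N] [LinearOrder β] [WellFoundedLT β] (e : α → N) (e' : α → N')
    (b' : β → N') (i : β) :
    matchingTuple L e e' b' i = Classical.epsilon fun c =>
      TupleEquiv L (Sum.elim (Sum.elim e fun k : Set.Iio i => matchingTuple L e e' b' k)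
        fun _ : Unit => c) (Sum.elim (Sum.elim e' fun k : Set.Iio i => b' k) fun _ => b' i) :=
  wellFounded_lt.fix_eq _ i

theorem IsSaturated.tupleEquiv_matchingTuple [Nonempty N] [LinearOrder β] [WellFoundedLT β]
    (hN : IsSaturated L N κ) (hκ : ℵ₀ ≤ κ) {e : α → N} {e' : α → N'} (he : #(Set.range e) < κ)
    (hβ : Cardinal.lift.{w} #β < Cardinal.lift.{x} κ) (h : TupleEquiv L e e') (b' : β → N')
    (i : β) :
    TupleEquiv L (Sum.elim e fun k : Set.Iic i => matchingTuple L e e' b' k)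
      (Sum.elim e' fun k : Set.Iic i => b' k) := by
  induction i using WellFoundedLT.induction with | ind i ih =>
  have hlt := h.sumElim_of_forall_Iic (s := Set.Iio i) ih
  have hcard : #(Set.range (Sum.elim e fun k : Set.Iio i => matchingTuple L e e' b' k)) < κ := by
    have hbκ : #(Set.range (matchingTuple L e e' b')) < κ :=
      lift_lt.1 (mk_range_le_lift.trans_lt hβ)
    rw [Set.Sum.elim_range]
    refine (mk_union_le _ _).trans_lt (add_lt_of_lt hκ he (hbκ.trans_le' (mk_le_mk_of_subset ?_)))
    exact Set.range_comp_subset_range (Subtype.val : Set.Iio i → β) _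
  have hi := Classical.epsilon_spec (hN.exists_tupleEquiv_unit hcard hlt (b' i))
  rw [← matchingTuple_eq] at hi
  let g : α ⊕ Set.Iic i → (α ⊕ Set.Iio i) ⊕ Unit := Sum.elim (.inl ∘ .inl) fun k =>
    if hk : k.1 < i then .inl (.inr ⟨k, hk⟩) else .inr ()
  convert hi.comp g using 1 <;>
  · funext k
    rcases k with k | ⟨k, hk⟩
    · rfl
    · by_cases hki : k < i
      · simp [g, hki]
      · simp [g, (show k ≤ i from hk).eq_of_not_lt hki]

theorem IsSaturated.exists_tupleEquiv_sumElim [Nonempty N] (hN : IsSaturated L N κ)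
    (hκ : ℵ₀ ≤ κ) {e : α → N} {e' : α → N'} (he : #(Set.range e) < κ)
    (hβ : Cardinal.lift.{w} #β < Cardinal.lift.{x} κ) (h : TupleEquiv L e e') (b' : β → N') :
    ∃ b : β → N, TupleEquiv L (Sum.elim e b) (Sum.elim e' b') := by
  obtain ⟨_, _⟩ := exists_wellFoundedLT β
  refine ⟨matchingTuple L e e' b', ?_⟩
  have := h.sumElim_of_forall_Iic (s := Set.univ) fun i _ =>
    hN.tupleEquiv_matchingTuple hκ he hβ h b' i
  convert this.comp (Sum.map id fun i => (⟨i, Set.mem_univ i⟩ : (Set.univ : Set β))) using 1 <;>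
    exact funext fun | .inl _ => rfl | .inr _ => rfl

theorem IsStronglyHomogeneous.exists_equiv (hN : IsStronglyHomogeneous L N κ) {e e' : α → N}
    (he : #(Set.range e) < κ) (h : TupleEquiv L e e') : ∃ σ : N ≃[L] N, ∀ i, σ (e i) = e' i := by
  obtain ⟨f, hf, hfe⟩ := h.exists_range_extension
  obtain ⟨σ, hσ⟩ := hN _ he f hf
  exact ⟨σ, fun i => (hσ ⟨e i, i, rfl⟩).trans (hfe i)⟩

end Saturation

section Types

variable {L : FirstOrder.Language.{u, v}} {C : Type w} [L.Structure C] {A : Set C} {ι : Type x}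

theorem contains_typeOf {N : Type*} [L[[A]].Structure N] [Nonempty N]
    [N ⊨ L[[A]].completeTheory C] [L.Structure N] [(L.lhomWithConstants A).IsExpansionOn N]
    (a : ι → N) (φ : L.Formula (A ⊕ ι)) :
    Contains ((L[[A]].completeTheory C).typeOf a) φ ↔
      φ.Realize (Sum.elim (fun c => (L.con c : N)) a) := by
  rw [Contains, Theory.CompleteType.formula_mem_typeOf]
  have := BoundedFormula.realize_constantsVarsEquiv (L := L) (M := N) (α := A)
    (φ := BoundedFormula.constantsVarsEquiv.symm φ) (v := a) (xs := default)
  rw [Equiv.apply_symm_apply] at this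
  exact this.symm

theorem exists_realization (p : TypeSpace L C A ι) :
    ∃ (N : Type (max u v w x)) (_ : L.Structure N) (_ : Nonempty N) (e : A → N) (a : ι → N),
      TupleEquiv L Subtype.val e ∧
      ∀ φ : L.Formula (A ⊕ ι), Contains p φ ↔ φ.Realize (Sum.elim e a) := by
  obtain ⟨N, a, rfl⟩ := Theory.exists_modelType_is_realized_in _ p
  let _ : L.Structure N := (L.lhomWithConstants A).reduct N
  refine ⟨N, inferInstance, inferInstance, fun c => (L.con c : N), a, fun φ => ?_,
    contains_typeOf a⟩
  exact (Formula.realize_equivSentence C φ).symm.trans <|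
    (realize_iff_of_model_completeTheory C N _).symm.trans (Formula.realize_equivSentence N φ)

theorem exists_contains_iff_realize {N : Type*} [L.Structure N] [Nonempty N] {e : A → N}
    (he : TupleEquiv L Subtype.val e) (a : ι → N) :
    ∃ p : TypeSpace L C A ι, ∀ φ : L.Formula (A ⊕ ι), Contains p φ ↔ φ.Realize (Sum.elim e a) := by
  let _ : (constantsOn A).Structure N := constantsOn.structure e
  have : N ⊨ L[[A]].completeTheory C := by
    refine ⟨fun σ hσ => (Formula.realize_equivSentence_symm N σ e).1 ((he _).1 ?_)⟩
    exact (Formula.realize_equivSentence_symm C σ _).2 hσ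
  exact ⟨Theory.typeOf _ a, contains_typeOf a⟩

/-- The type over `A` of a tuple of `C`. -/
noncomputable def tpOver [Nonempty C] (A : Set C) (a : ι → C) : TypeSpace L C A ι :=
  Theory.typeOf _ a

theorem contains_tpOver [Nonempty C] (a : ι → C) (φ : L.Formula (A ⊕ ι)) :
    Contains (tpOver A a) φ ↔ φ.Realize (Sum.elim Subtype.val a) :=
  contains_typeOf a φ

theorem exists_contains_iff_mem (φ : L[[A]][[ι]].Sentence) :
    ∃ ψ : L.Formula (A ⊕ ι), ∀ p : TypeSpace L C A ι, Contains p ψ ↔ φ ∈ p := by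
  refine ⟨BoundedFormula.constantsVarsEquiv (Formula.equivSentence.symm φ), fun p => ?_⟩
  rw [Contains, Equiv.symm_apply_apply, Equiv.apply_symm_apply]

theorem typeSpace_ext {p q : TypeSpace L C A ι}
    (h : ∀ φ : L.Formula (A ⊕ ι), Contains p φ ↔ Contains q φ) : p = q := by
  refine SetLike.ext fun φ => ?_
  obtain ⟨ψ, hψ⟩ := exists_contains_iff_mem (A := A) (C := C) φ
  rw [← hψ, ← hψ, h]

theorem contains_iSup {I : Type*} [Finite I] (p : TypeSpace L C A ι)
    (φ : I → L.Formula (A ⊕ ι)) : Contains p (Formula.iSup φ) ↔ ∃ i, Contains p (φ i) := by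
  obtain ⟨N, _, _, e, a, -, h⟩ := exists_realization p
  simp only [h, Formula.realize_iSup]

theorem contains_top (p : TypeSpace L C A ι) : Contains p ⊤ := by
  obtain ⟨N, _, _, e, a, -, h⟩ := exists_realization p
  exact (h _).2 (Formula.realize_top.2 trivial)

theorem isClopen_contains (φ : L.Formula (A ⊕ ι)) :
    IsClopen {p : TypeSpace L C A ι | Contains p φ} :=
  CompleteType.isClopen_typesWith _

theorem isTopologicalBasis_contains : TopologicalSpace.IsTopologicalBasis
    (Set.range fun φ : L.Formula (A ⊕ ι) => {p : TypeSpace L C A ι | Contains p φ}) := by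
  convert CompleteType.isTopologicalBasis_range_typesWith (T := L[[A]].completeTheory C) (α := ι)
    using 1
  refine Set.Subset.antisymm (Set.range_subset_iff.2 fun φ => ⟨_, rfl⟩)
    (Set.range_subset_iff.2 fun φ => ?_)
  obtain ⟨ψ, hψ⟩ := exists_contains_iff_mem (A := A) (C := C) φ
  exact ⟨ψ, Set.ext hψ⟩

theorem exists_setOf_contains_eq {U : Set (TypeSpace L C A ι)} (hU : IsClopen U) :
    ∃ φ : L.Formula (A ⊕ ι), {p | Contains p φ} = U := by
  obtain ⟨s, hs, rfl⟩ := eq_finite_iUnion_of_isTopologicalBasis_of_isCompact_open _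
    isTopologicalBasis_contains U hU.isClosed.isCompact hU.isOpen
  have : Finite s := hs
  exact ⟨Formula.iSup fun φ : s => φ.1, Set.ext fun p => by simp [contains_iSup]⟩

theorem isClosed_typesExtending (m : ι → C) : IsClosed (typesExtending L m) := by
  simp only [typesExtending, Set.ofPred_forall]
  exact isClosed_iInter fun φ => isClosed_iInter fun _ => (isClopen_contains _).isClosed

theorem continuous_of_isClopen_contains {X : Type*} [TopologicalSpace X]
    {f : X → TypeSpace L C A ι} (hf : ∀ φ : L.Formula (A ⊕ ι), IsClopen {x | Contains (f x) φ}) :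
    Continuous f :=
  isTopologicalBasis_contains.continuous_iff.2 <| Set.forall_mem_range.2 fun φ => (hf φ).isOpen

theorem IsSaturated.exists_realizes [Nonempty C] {κ : Cardinal.{w}} (hC : IsSaturated L C κ)
    (hκ : ℵ₀ ≤ κ) (hA : #A < κ) (hι : Cardinal.lift.{w} #ι < Cardinal.lift.{x} κ)
    (p : TypeSpace L C A ι) : ∃ a : ι → C, Realizes id a p := by
  obtain ⟨N, _, _, e, a', he, h⟩ := exists_realization p
  obtain ⟨a, ha⟩ := hC.exists_tupleEquiv_sumElim hκ (Subtype.range_val.symm ▸ hA) hι he a'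
  exact ⟨a, fun φ => (h φ).trans (ha φ).symm⟩

end Types

section Borel

open TopologicalSpace

variable {L : FirstOrder.Language.{u, v}} {C : Type w} [L.Structure C] {A : Set C} {ι : Type x}

theorem exists_solutionSet_eq (X : L.DefinableSet A ι) :
    ∃ φ : L.Formula (A ⊕ ι), solutionSet φ = X := by
  obtain ⟨φ, hφ⟩ := Set.definable_iff_exists_formula_sum.1 X.2
  exact ⟨φ, Subtype.ext hφ.symm⟩

namespace KeislerMeasure

theorem le_one (μ : KeislerMeasure L C A ι) (X : L.DefinableSet A ι) : μ X ≤ 1 :=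
  (monotone_of_additive μ.nonneg μ.additive le_top).trans_eq μ.top_eq_one

theorem ext {μ ν : KeislerMeasure L C A ι} (h : ∀ X, μ X = ν X) : μ = ν := by
  cases μ
  cases ν
  congr
  exact funext h

end KeislerMeasure

variable [Nonempty C]

/-- The `A`-definable set that corresponds to a clopen set `U` of types over `A`. -/
noncomputable def definableSetOf (U : Clopens (TypeSpace L C A ι)) : L.DefinableSet A ι :=
  ⟨{a | tpOver A a ∈ U}, by
    obtain ⟨φ, hφ⟩ := exists_setOf_contains_eq U.isClopen
    exact Set.definable_iff_exists_formula_sum.2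
      ⟨φ, Set.ext fun a => (Set.ext_iff.1 hφ (tpOver A a)).symm.trans (contains_tpOver a φ)⟩⟩

theorem definableSetOf_contains (φ : L.Formula (A ⊕ ι)) :
    definableSetOf ⟨{p | Contains p φ}, isClopen_contains (C := C) φ⟩ = solutionSet φ :=
  SetLike.ext fun a => contains_tpOver a φ

theorem definableSetOf_sup (U V : Clopens (TypeSpace L C A ι)) :
    definableSetOf (U ⊔ V) = definableSetOf U ⊔ definableSetOf V := rfl

theorem disjoint_definableSetOf {U V : Clopens (TypeSpace L C A ι)} (h : Disjoint U V) :
    Disjoint (definableSetOf U) (definableSetOf V) := by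
  refine disjoint_iff.2 (SetLike.ext fun a => ⟨fun ha => ?_, fun ha =>
    (DefinableSet.notMem_bot ha).elim⟩)
  exact (h.eq_bot ▸ (show tpOver A a ∈ U ⊓ V from ha) : tpOver A a ∈ (⊥ : Clopens _))

theorem exists_isBorelExtension (μ : KeislerMeasure L C A ι) : ∃ η, IsBorelExtension μ η := by
  obtain ⟨η, hη, h⟩ := exists_regular_measure_of_additive
    (fun U : Clopens (TypeSpace L C A ι) => (μ (definableSetOf U)).toNNReal) fun U V hUV => by
      rw [definableSetOf_sup, μ.additive _ _ (disjoint_definableSetOf hUV),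
        Real.toNNReal_add (μ.nonneg _) (μ.nonneg _)]
  exact ⟨η, hη, fun φ => (h ⟨_, isClopen_contains φ⟩).trans
    (congrArg (ENNReal.ofReal ∘ μ.toFun) (definableSetOf_contains φ))⟩

theorem isBorelExtension_borelMeasure (μ : KeislerMeasure L C A ι) :
    IsBorelExtension μ (borelMeasure μ) :=
  Classical.epsilon_spec (exists_isBorelExtension μ)

instance (μ : KeislerMeasure L C A ι) : (borelMeasure μ).Regular :=
  (isBorelExtension_borelMeasure μ).1

theorem borelMeasure_real_contains (μ : KeislerMeasure L C A ι) (φ : L.Formula (A ⊕ ι)) :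
    (borelMeasure μ).real {p | Contains p φ} = μ (solutionSet φ) := by
  rw [measureReal_def, (isBorelExtension_borelMeasure μ).2 φ, ENNReal.toReal_ofReal (μ.nonneg _)]

instance (μ : KeislerMeasure L C A ι) : IsProbabilityMeasure (borelMeasure μ) := by
  have h := (isBorelExtension_borelMeasure μ).2 ⊤
  have htop : solutionSet (⊤ : L.Formula (A ⊕ ι)) = (⊤ : L.DefinableSet A ι) :=
    SetLike.ext fun a => iff_of_true (Formula.realize_top.2 trivial) DefinableSet.mem_top
  rw [show {p : TypeSpace L C A ι | Contains p ⊤} = Set.univ from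
    Set.eq_univ_of_forall contains_top, htop, μ.top_eq_one, ENNReal.ofReal_one] at h
  exact ⟨h⟩

theorem borelMeasure_contains_eq_one_iff (μ : KeislerMeasure L C A ι) (φ : L.Formula (A ⊕ ι)) :
    borelMeasure μ {p | Contains p φ} = 1 ↔ μ (solutionSet φ) = 1 := by
  rw [(isBorelExtension_borelMeasure μ).2, ENNReal.ofReal_eq_one]

theorem concentratesOn_iff {m : ι → C} {μ : GlobalMeasure L C ι} : ConcentratesOn m μ ↔
    ∀ φ : L.Formula ι, φ.Realize m → μ (solutionSet (φ.relabel Sum.inr)) = 1 := by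
  simp only [← borelMeasure_contains_eq_one_iff]
  refine ⟨fun h φ hφ => prob_le_one.antisymm (h ▸ measure_mono fun p hp => hp φ hφ), fun h => ?_⟩
  have hU (φ : {φ : L.Formula ι // φ.Realize m}) :
      IsOpen {p : TypeSpace L C Set.univ ι | Contains p (φ.1.relabel Sum.inr)}ᶜ :=
    (isClopen_contains _).isClosed.isOpen_compl
  have hnull := measure_iUnion_isOpen_null (η := borelMeasure μ) hU fun φ =>
    (prob_compl_eq_zero_iff (isClopen_contains _).isClosed.measurableSet).2
      (h φ.1 φ.2)
  rw [ConcentratesOn, ← prob_compl_eq_zero_iff (isClosed_typesExtending m).measurableSet]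
  refine measure_mono_null (fun p hp => ?_) hnull
  simpa [typesExtending] using hp

end Borel

section Conjugates

variable {L : FirstOrder.Language.{u, v}} {C : Type w} {ι β γ : Type*}

/-- The formula `φ(b; y)` with parameters from `C`. -/
def plug (φ : L.Formula (β ⊕ ι)) (b : β → C) : L.Formula ((Set.univ : Set C) ⊕ ι) :=
  φ.relabel (Sum.map (fun i => ⟨b i, Set.mem_univ (b i)⟩) id)

theorem realize_plug {N : Type*} [L.Structure N] (e : ↥(Set.univ : Set C) → N)
    (φ : L.Formula (β ⊕ ι)) (b : β → C) (a : ι → N) : (plug φ b).Realize (Sum.elim e a) ↔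
      φ.Realize (Sum.elim (fun i => e ⟨b i, Set.mem_univ (b i)⟩) a) := by
  rw [plug, Formula.realize_relabel, Sum.elim_comp_map]
  rfl

variable [L.Structure C]

theorem solutionSet_plug (φ : L.Formula (β ⊕ ι)) (b : β → C) :
    solutionSet (plug φ b) = fiber φ b := rfl

variable {M : L.ElementarySubstructure C}

/-- For a formula `φ(x)` over `M`, the formula `φ*(x; y)` over `∅` with `φ(x) = φ*(x; m)`. -/
def dual (m : ι ≃ M) (φ : L.Formula ((M : Set C) ⊕ β)) : L.Formula (β ⊕ ι) :=
  φ.relabel (Sum.elim (Sum.inr ∘ m.symm) Sum.inl)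

theorem realize_dual {N : Type*} [L.Structure N] (m : ι ≃ M) (φ : L.Formula ((M : Set C) ⊕ β))
    (b : β → N) (a : ι → N) :
    (dual m φ).Realize (Sum.elim b a) ↔ φ.Realize (Sum.elim (a ∘ m.symm) b) := by
  rw [dual, Formula.realize_relabel]
  exact iff_of_eq (congrArg φ.Realize (funext fun | .inl _ => rfl | .inr _ => rfl))

end Conjugates

section ConjugateType

variable {L : FirstOrder.Language.{u, v}} {C : Type w} [L.Structure C]
  {M : L.ElementarySubstructure C} {ι : Type w} {m : ι ≃ M} {β γ : Type*}

theorem tuple_comp_symm (m : ι ≃ M) : tuple m ∘ m.symm = Subtype.val :=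
  funext fun c => congrArg Subtype.val (m.apply_symm_apply c)

theorem tupleEquiv_of_mem_typesExtending {p : TypeSpace L C Set.univ ι} {a₀ : ι → C}
    (hp : p ∈ typesExtending L a₀) {N : Type*} [L.Structure N] {e : ↥(Set.univ : Set C) → N}
    {a : ι → N} (ha : ∀ φ : L.Formula (Set.univ ⊕ ι), Contains p φ ↔ φ.Realize (Sum.elim e a)) :
    TupleEquiv L a₀ a :=
  .of_imp fun φ hφ => by
    simpa only [Formula.realize_relabel, Sum.elim_comp_inr] using (ha _).1 (hp φ hφ)

theorem exists_conjugateType {p : TypeSpace L C Set.univ ι} (hp : p ∈ typesExtending L (tuple m))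
    (b : β → C) : ∃ q : TypeSpace L C (M : Set C) β,
      ∀ φ : L.Formula ((M : Set C) ⊕ β), Contains q φ ↔ Contains p (plug (dual m φ) b) := by
  obtain ⟨N, _, _, e, a, -, ha⟩ := exists_realization p
  have hM := (tupleEquiv_of_mem_typesExtending hp ha).comp m.symm
  rw [tuple_comp_symm] at hM
  obtain ⟨q, hq⟩ := exists_contains_iff_realize hM fun i => e ⟨b i, Set.mem_univ (b i)⟩
  exact ⟨q, fun φ => by rw [hq, ha, realize_plug, realize_dual]⟩

/-- For `p = tp(σ(m)/C)` and a tuple `b` of `C`, of any length, the type `tp(σ⁻¹(b)/M)`. It is read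
off from `p` syntactically: `φ(x; m)` belongs to it if and only if `φ(b; y)` belongs to `p`. -/
noncomputable def conjugateType (m : ι ≃ M) (b : β → C) (p : typesExtending L (tuple m)) :
    TypeSpace L C (M : Set C) β :=
  Classical.choose (exists_conjugateType p.2 b)

theorem contains_conjugateType (b : β → C) (p : typesExtending L (tuple m))
    (φ : L.Formula ((M : Set C) ⊕ β)) :
    Contains (conjugateType m b p) φ ↔ Contains p.1 (plug (dual m φ) b) :=
  Classical.choose_spec (exists_conjugateType p.2 b) φ

theorem continuous_conjugateType (m : ι ≃ M) (b : β → C) :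
    Continuous (conjugateType (L := L) m b) :=
  continuous_of_isClopen_contains fun φ => by
    simp only [contains_conjugateType]
    exact (isClopen_contains _).preimage continuous_subtype_val

variable {p : typesExtending L (tuple m)} {b d : β → C}

theorem tupleEquiv_of_realizes_conjugateType (hd : Realizes id d (conjugateType m b p)) :
    TupleEquiv L b d := fun θ => by
  obtain ⟨N, _, _, e, a, he, ha⟩ := exists_realization p.1
  have h := hd (θ.relabel Sum.inr)
  rw [contains_conjugateType, ha, realize_plug, realize_dual, Formula.realize_relabel,
    Formula.realize_relabel] at h
  exact (he.comp (fun i => ⟨b i, Set.mem_univ (b i)⟩) θ).trans h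

theorem realizes_conjugateType_comp (hd : Realizes id d (conjugateType m b p)) (g : γ → β) :
    Realizes id (d ∘ g) (conjugateType m (b ∘ g) p) := fun φ => by
  obtain ⟨N, _, _, e, a, -, ha⟩ := exists_realization p.1
  have h := hd (φ.relabel (Sum.map id g))
  simp only [contains_conjugateType, ha, realize_plug, realize_dual, Formula.realize_relabel,
    Sum.elim_comp_map, Function.comp_id] at h ⊢
  exact h

end ConjugateType

section LargerMonster

variable {L : FirstOrder.Language.{u, v}} {C : Type w} [L.Structure C]
  {M : L.ElementarySubstructure C} {ι : Type w} {C' : Type w'} [L.Structure C']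
  {κ' : Cardinal.{w'}} {j : C ↪ₑ[L] C'} {m : ι ≃ M}

theorem realizes_conjugateType_of_automorphism {p : typesExtending L (tuple m)} {σ : C' ≃[L] C'}
    (hσ : Realizes j (fun i => σ (j (tuple m i))) p.1) {β : Type*} (b : β → C) :
    Realizes j (fun i => σ.symm (j (b i))) (conjugateType m b p) := fun φ => by
  rw [contains_conjugateType, hσ, realize_plug, realize_dual]
  refine Iff.trans (iff_of_eq (congrArg φ.Realize ?_)) (StrongHomClass.realize_formula σ φ)
  exact funext fun | .inl c => by simp [tuple] | .inr i => by simp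

variable [Infinite C]

theorem exists_automorphism_realizes (hC' : IsMonster L C' κ') (hj : #(Set.range j) < κ')
    {a₀ : ι → C} (hι : Cardinal.lift.{w'} #ι < Cardinal.lift.{w} κ')
    {p : TypeSpace L C Set.univ ι} (hp : p ∈ typesExtending L a₀) :
    ∃ σ : C' ≃[L] C', Realizes j (fun i => σ (j (a₀ i))) p := by
  have : Nonempty C' := ⟨j (Classical.arbitrary C)⟩
  have : Infinite (Set.range j) := (Set.infinite_range_of_injective j.injective).to_subtype
  obtain ⟨N, _, _, e, a, he, ha⟩ := exists_realization p
  let j₀ : ↥(Set.univ : Set C) → C' := fun c => j c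
  have hj₀ : #(Set.range j₀) < κ' :=
    (mk_le_mk_of_subset (Set.range_comp_subset_range Subtype.val j)).trans_lt hj
  obtain ⟨a', ha'⟩ := hC'.saturated.exists_tupleEquiv_sumElim ((aleph0_le_mk _).trans hj.le) hj₀ hι
    ((tupleEquiv_embedding j _).symm.trans he) a
  have hreal : Realizes j a' p := fun φ => (ha φ).trans (ha' φ).symm
  obtain ⟨σ, hσ⟩ := hC'.homogeneous.exists_equiv
    ((mk_le_mk_of_subset (Set.range_comp_subset_range a₀ j)).trans_lt hj)
    ((tupleEquiv_embedding j a₀).symm.trans (tupleEquiv_of_mem_typesExtending hp hreal))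
  exact ⟨σ, (funext hσ : (fun i => σ (j (a₀ i))) = a') ▸ hreal⟩

theorem hMap_eq_conjugateType (hC' : IsMonster L C' κ') (hj : #(Set.range j) < κ') (b : ι → C) :
    hMap j m b = conjugateType m b := by
  funext p
  have hι : Cardinal.lift.{w'} #ι < Cardinal.lift.{w} κ' := by
    rw [← mk_range_eq_of_injective (j.injective.comp (Subtype.val_injective.comp m.injective)),
      lift_lt]
    exact (mk_le_mk_of_subset (Set.range_comp_subset_range _ j)).trans_lt hj
  obtain ⟨σ₀, hσ₀⟩ := exists_automorphism_realizes hC' hj hι p.2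
  obtain ⟨σ, hσ, hq⟩ := Classical.epsilon_spec (p := fun q => ∃ σ : C' ≃[L] C',
    Realizes j (fun i => σ (j (tuple m i))) p.1 ∧ Realizes j (fun i => σ.symm (j (b i))) q)
    ⟨_, σ₀, hσ₀, realizes_conjugateType_of_automorphism hσ₀ b⟩
  exact typeSpace_ext fun φ => (hq φ).trans (realizes_conjugateType_of_automorphism hσ b φ).symm

end LargerMonster

section Fibers

variable {L : FirstOrder.Language.{u, v}} {C : Type w} [L.Structure C] {ι : Type x} {β γ : Type*}

theorem fiber_relabel (φ : L.Formula (γ ⊕ ι)) (g : γ → β) (b : β → C) :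
    fiber (φ.relabel (Sum.map g id)) b = fiber φ (b ∘ g) :=
  SetLike.ext fun a => by
    rw [mem_fiber, mem_fiber, Formula.realize_relabel, Sum.elim_comp_map, Function.comp_id]

theorem fiber_sup (φ ψ : L.Formula (β ⊕ ι)) (b : β → C) :
    fiber (φ ⊔ ψ) b = fiber φ b ⊔ fiber ψ b :=
  SetLike.ext fun a => by
    rw [DefinableSet.mem_sup, mem_fiber, mem_fiber, mem_fiber, Formula.realize_sup]

theorem fiber_inf (φ ψ : L.Formula (β ⊕ ι)) (b : β → C) :
    fiber (φ ⊓ ψ) b = fiber φ b ⊓ fiber ψ b :=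
  SetLike.ext fun a => by
    rw [DefinableSet.mem_inf, mem_fiber, mem_fiber, mem_fiber, Formula.realize_inf]

theorem fiber_top (b : β → C) : fiber (⊤ : L.Formula (β ⊕ ι)) b = ⊤ :=
  SetLike.ext fun a => by
    rw [mem_fiber, Formula.realize_top]
    exact iff_of_true trivial DefinableSet.mem_top

theorem fiber_bot (b : β → C) : fiber (⊥ : L.Formula (β ⊕ ι)) b = ⊥ :=
  SetLike.ext fun a => by
    rw [mem_fiber, Formula.realize_bot]
    exact iff_of_false id DefinableSet.notMem_bot

theorem fiber_relabel_inr (φ : L.Formula ι) (b : β → C) :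
    fiber (φ.relabel Sum.inr) b = solutionSet (φ.relabel Sum.inr) :=
  SetLike.ext fun a => by
    change _ ↔ (φ.relabel Sum.inr).Realize (Sum.elim Subtype.val a)
    rw [mem_fiber, Formula.realize_relabel, Formula.realize_relabel, Sum.elim_comp_inr,
      Sum.elim_comp_inr]

theorem TupleEquiv.fiber_le [Nonempty C] {b d : β → C} (h : TupleEquiv L b d)
    {φ ψ : L.Formula (β ⊕ ι)} (hφψ : fiber φ b ≤ fiber ψ b) : fiber φ d ≤ fiber ψ d := by
  intro a ha
  rw [mem_fiber] at ha ⊢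
  by_contra hψ
  obtain ⟨a', ha'⟩ := h.symm.exists_realize (ψ := φ ⊓ ψ.not) (b := a)
    (Formula.realize_inf.2 ⟨ha, Formula.realize_not.2 hψ⟩)
  rw [Formula.realize_inf, Formula.realize_not, ← mem_fiber, ← mem_fiber] at ha'
  exact ha'.2 (hφψ ha'.1)

theorem TupleEquiv.disjoint_fiber [Nonempty C] {b d : β → C} (h : TupleEquiv L b d)
    {φ ψ : L.Formula (β ⊕ ι)} (hφψ : Disjoint (fiber φ b) (fiber ψ b)) :
    Disjoint (fiber φ d) (fiber ψ d) := by
  rw [disjoint_iff_inf_le, ← fiber_inf, ← fiber_bot] at hφψ ⊢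
  exact h.fiber_le hφψ

theorem exists_fiber_eq [Nonempty C] [Infinite β] (X : L.DefinableSet (Set.univ : Set C) ι) :
    ∃ (φ : L.Formula (β ⊕ ι)) (b : β → C), fiber φ b = X := by
  classical
  obtain ⟨ψ, rfl⟩ := exists_solutionSet_eq X
  obtain ⟨g⟩ : Nonempty (ψ.freeVarFinset.toLeft ↪ β) := ⟨(Fintype.equivFin _).toEmbedding.trans
    (Fin.valEmbedding.trans (Infinite.natEmbedding β))⟩
  let f : ψ.freeVarFinset → β ⊕ ι := fun
    | ⟨.inl c, h⟩ => .inl (g ⟨c, Finset.mem_toLeft.2 h⟩)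
    | ⟨.inr i, _⟩ => .inr i
  refine ⟨ψ.restrictFreeVar f, Function.extend g (fun c => c.1.1) fun _ => Classical.arbitrary C,
    SetLike.ext fun a => (mem_fiber _ _ _).trans (BoundedFormula.realize_restrictFreeVar _ ?_)⟩
  rintro ⟨c | i, h⟩
  · change Function.extend g (fun c => c.1.1) (fun _ => Classical.arbitrary C) (g ⟨c, _⟩) = c.1
    rw [g.injective.extend_apply]
  · rfl

theorem exists_fiber_eq_and_fiber_eq [Nonempty C] [Infinite β]
    (X Y : L.DefinableSet (Set.univ : Set C) ι) :
    ∃ (φ ψ : L.Formula ((β ⊕ β) ⊕ ι)) (b : β ⊕ β → C), fiber φ b = X ∧ fiber ψ b = Y := by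
  obtain ⟨φ, b, rfl⟩ := exists_fiber_eq (β := β) X
  obtain ⟨ψ, c, rfl⟩ := exists_fiber_eq (β := β) Y
  exact ⟨_, _, Sum.elim b c, fiber_relabel φ Sum.inl _, fiber_relabel ψ Sum.inr _⟩

end Fibers

section FiberMap

variable {L : FirstOrder.Language.{u, v}} {C : Type w} [L.Structure C] [Nonempty C]
  {M : L.ElementarySubstructure C} {ι : Type x} {β : Type w} {κ : Cardinal.{w}}
  {μ : GlobalMeasure L C ι}

theorem IsInvariantOver.fiberMap_eq (hμ : IsInvariantOver κ M μ) (hβ : #β < κ)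
    (φ : L.Formula (β ⊕ ι)) {q : TypeSpace L C (M : Set C) β} {b : β → C}
    (hb : Realizes id b q) : fiberMap M μ φ q = μ (fiber φ b) :=
  hμ β hβ φ _ _ fun ψ =>
    (Classical.epsilon_spec (p := fun b => Realizes id b q) ⟨b, hb⟩ ψ).symm.trans (hb ψ)

theorem IsDefinable.isBorelDefinable (hμ : IsDefinable κ M μ) : IsBorelDefinable κ M μ :=
  ⟨hμ.invariant, fun β hβ φ => (hμ.continuous β hβ φ).measurable⟩

end FiberMap

section SmallModel

variable {L : FirstOrder.Language.{u, v}} {C : Type w} [L.Structure C] [Infinite C]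
  {M : L.ElementarySubstructure C} {κ : Cardinal.{w}}

theorem infinite_elementarySubstructure (M : L.ElementarySubstructure C) : Infinite M :=
  M.elementarilyEquivalent.infinite_iff.2 inferInstance

theorem aleph0_le_of_mk_lt (hM : #M < κ) : ℵ₀ ≤ κ :=
  have := infinite_elementarySubstructure M
  (aleph0_le_mk M).trans hM.le

theorem IsSaturated.exists_realizes_of_mk_lt (hC : IsSaturated L C κ) (hM : #M < κ) {β : Type w}
    (hβ : #β < κ) (q : TypeSpace L C (M : Set C) β) : ∃ b : β → C, Realizes id b q :=
  hC.exists_realizes (aleph0_le_of_mk_lt hM) hM (lift_lt.2 hβ) q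

end SmallModel

section ConjugateMeasure

variable {L : FirstOrder.Language.{u, v}} {C : Type w} [L.Structure C] [Infinite C]
  {M : L.ElementarySubstructure C} {ι : Type w} {m : ι ≃ M} {κ : Cardinal.{w}}
  {μ : GlobalMeasure L C ι} {β γ : Type w}

theorem fiberMap_conjugateType_relabel (hC : IsSaturated L C κ) (hM : #M < κ)
    (hμ : IsInvariantOver κ M μ) (hβ : #β < κ) (hγ : #γ < κ) (φ : L.Formula (γ ⊕ ι)) (g : γ → β)
    (b : β → C) (p : typesExtending L (tuple m)) :
    fiberMap M μ (φ.relabel (Sum.map g id)) (conjugateType m b p) =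
      fiberMap M μ φ (conjugateType m (b ∘ g) p) := by
  obtain ⟨d, hd⟩ := hC.exists_realizes_of_mk_lt hM hβ (conjugateType m b p)
  rw [hμ.fiberMap_eq hβ _ hd, hμ.fiberMap_eq hγ _ (realizes_conjugateType_comp hd g), fiber_relabel]

theorem fiberMap_conjugateType_congr (hC : IsSaturated L C κ) (hM : #M < κ)
    (hμ : IsInvariantOver κ M μ) (hβ : #β < κ) {φ ψ : L.Formula (β ⊕ ι)} {b : β → C}
    (h : fiber φ b = fiber ψ b) (p : typesExtending L (tuple m)) :
    fiberMap M μ φ (conjugateType m b p) = fiberMap M μ ψ (conjugateType m b p) := by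
  obtain ⟨d, hd⟩ := hC.exists_realizes_of_mk_lt hM hβ (conjugateType m b p)
  have hbd := tupleEquiv_of_realizes_conjugateType hd
  rw [hμ.fiberMap_eq hβ _ hd, hμ.fiberMap_eq hβ _ hd,
    (hbd.fiber_le h.le).antisymm (hbd.fiber_le h.ge)]

theorem fiberMap_conjugateType_congr_of_fiber_eq (hC : IsSaturated L C κ) (hM : #M < κ)
    (hμ : IsInvariantOver κ M μ) (hβ : #β < κ) (hγ : #γ < κ) {φ : L.Formula (β ⊕ ι)}
    {ψ : L.Formula (γ ⊕ ι)} {b : β → C} {c : γ → C} (h : fiber φ b = fiber ψ c)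
    (p : typesExtending L (tuple m)) :
    fiberMap M μ φ (conjugateType m b p) = fiberMap M μ ψ (conjugateType m c p) := by
  have hβγ : #(β ⊕ γ) < κ := by
    rw [mk_sum, lift_id, lift_id]
    exact add_lt_of_lt (aleph0_le_of_mk_lt hM) hβ hγ
  have hφ := fiberMap_conjugateType_relabel hC hM hμ hβγ hβ φ Sum.inl (Sum.elim b c) p
  have hψ := fiberMap_conjugateType_relabel hC hM hμ hβγ hγ ψ Sum.inr (Sum.elim b c) p
  rw [Sum.elim_comp_inl] at hφ
  rw [Sum.elim_comp_inr] at hψ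
  rw [← hφ, ← hψ]
  refine fiberMap_conjugateType_congr hC hM hμ hβγ ?_ p
  rw [fiber_relabel, fiber_relabel, Sum.elim_comp_inl, Sum.elim_comp_inr, h]

theorem fiberMap_conjugateType_sup (hC : IsSaturated L C κ) (hM : #M < κ)
    (hμ : IsInvariantOver κ M μ) (hβ : #β < κ) {φ ψ : L.Formula (β ⊕ ι)} {b : β → C}
    (h : Disjoint (fiber φ b) (fiber ψ b)) (p : typesExtending L (tuple m)) :
    fiberMap M μ (φ ⊔ ψ) (conjugateType m b p) =
      fiberMap M μ φ (conjugateType m b p) + fiberMap M μ ψ (conjugateType m b p) := by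
  obtain ⟨d, hd⟩ := hC.exists_realizes_of_mk_lt hM hβ (conjugateType m b p)
  simp only [hμ.fiberMap_eq hβ _ hd, fiber_sup]
  exact μ.additive _ _ ((tupleEquiv_of_realizes_conjugateType hd).disjoint_fiber h)

/-- For `p = tp(σ(m)/C)` this is the conjugate of (the extension to `C'` of) `μ` by `σ`, restricted
to `C`; its mean with respect to `p` is the convolution product. -/
theorem exists_conjugateMeasure (hC : IsSaturated L C κ) (hM : #M < κ)
    (hμ : IsInvariantOver κ M μ) (p : typesExtending L (tuple m)) :
    ∃ ρ : GlobalMeasure L C ι, ∀ β : Type w, #β < κ → ∀ (φ : L.Formula (β ⊕ ι)) (b : β → C),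
      ρ (fiber φ b) = fiberMap M μ φ (conjugateType m b p) := by
  have hι : #ι < κ := (mk_congr m).trans_lt hM
  have : Infinite ι := m.infinite_iff.2 (infinite_elementarySubstructure M)
  choose Φ B hΦB using exists_fiber_eq (L := L) (C := C) (ι := ι) (β := ι)
  have hfiber (β : Type w) (hβ : #β < κ) (φ : L.Formula (β ⊕ ι)) (b : β → C) :
      fiberMap M μ (Φ (fiber φ b)) (conjugateType m (B (fiber φ b)) p) =
        fiberMap M μ φ (conjugateType m b p) :=
    fiberMap_conjugateType_congr_of_fiber_eq hC hM hμ hι hβ (hΦB _) p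
  refine ⟨⟨fun X => fiberMap M μ (Φ X) (conjugateType m (B X) p), fun X => μ.nonneg _, ?_, ?_⟩,
    hfiber⟩
  · have h := hfiber ι hι ⊤ (tuple m)
    rw [fiber_top] at h
    rw [h, fiberMap, fiber_top, μ.top_eq_one]
  · intro X Y hXY
    have hιι : #(ι ⊕ ι) < κ := by
      rw [mk_sum, lift_id]
      exact add_lt_of_lt (aleph0_le_of_mk_lt hM) hι hι
    obtain ⟨φ, ψ, b, rfl, rfl⟩ := exists_fiber_eq_and_fiber_eq (β := ι) X Y
    rw [← fiber_sup, hfiber _ hιι, hfiber _ hιι, hfiber _ hιι,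
      fiberMap_conjugateType_sup hC hM hμ hιι hXY]

end ConjugateMeasure

section Average

variable {L : FirstOrder.Language.{u, v}} {C : Type w} [L.Structure C] {A : Set C} {ι : Type x}

/-- The mean of a measurable family of Keisler measures with respect to a probability measure on
the space of parameters. -/
noncomputable def KeislerMeasure.average {Y : Type*} [MeasurableSpace Y]
    (ρ : Y → KeislerMeasure L C A ι) (hρ : ∀ X, Measurable fun y => ρ y X) (η : Measure Y)
    [IsProbabilityMeasure η] : KeislerMeasure L C A ι where
  toFun X := ∫ y, ρ y X ∂η
  nonneg X := integral_nonneg fun y => (ρ y).nonneg X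
  top_eq_one := by simp [KeislerMeasure.top_eq_one]
  additive X Y h := by
    have hint (X) : Integrable (fun y => ρ y X) η := .of_bound (hρ X).aestronglyMeasurable 1
      (.of_forall fun y => (Real.norm_of_nonneg ((ρ y).nonneg X)).trans_le ((ρ y).le_one X))
    rw [← integral_add (hint X) (hint Y)]
    exact integral_congr_ae (.of_forall fun y => (ρ y).additive X Y h)

end Average

section ConjugatePush

variable {L : FirstOrder.Language.{u, v}} {C : Type w} [L.Structure C]
  {M : L.ElementarySubstructure C} {ι : Type w} {m : ι ≃ M} {β : Type*}
  {ν : GlobalMeasure L C ι}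

theorem ConcentratesOn.isProbabilityMeasure_comap {a₀ : ι → C} (hν : ConcentratesOn a₀ ν) :
    IsProbabilityMeasure ((borelMeasure ν).comap (Subtype.val : typesExtending L a₀ → _)) :=
  ⟨by
    rw [(MeasurableEmbedding.subtype_coe (isClosed_typesExtending a₀).measurableSet).comap_apply,
      Set.image_univ, Subtype.range_coe]
    exact hν⟩

/-- The measure `(h_b)_*(ν)` on `S_β(M)`, with the map `h_b` given by `conjugateType`, for
tuples `b` of any length. -/
noncomputable def conjugatePush (m : ι ≃ M) (b : β → C) (ν : GlobalMeasure L C ι) :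
    Measure (TypeSpace L C (M : Set C) β) :=
  ((borelMeasure ν).comap (Subtype.val : typesExtending L (tuple m) → _)).map (conjugateType m b)

theorem ConcentratesOn.isProbabilityMeasure_conjugatePush (hν : ConcentratesOn (tuple m) ν)
    (b : β → C) : IsProbabilityMeasure (conjugatePush m b ν) :=
  have := hν.isProbabilityMeasure_comap
  Measure.isProbabilityMeasure_map (continuous_conjugateType m b).measurable.aemeasurable

variable [Nonempty C]

instance (b : β → C) (ν : GlobalMeasure L C ι) : (conjugatePush m b ν).Regular :=
  regular_map_comap_subtype _ (isClosed_typesExtending _) (continuous_conjugateType m b)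

theorem ConcentratesOn.conjugatePush_real_contains (hν : ConcentratesOn (tuple m) ν) (b : β → C)
    (φ : L.Formula ((M : Set C) ⊕ β)) :
    (conjugatePush m b ν).real {q | Contains q φ} = ν (fiber (dual m φ) b) := by
  have hS := (isClosed_typesExtending (L := L) (tuple m)).measurableSet
  have hpre : conjugateType m b ⁻¹' {q | Contains q φ} =
      Subtype.val ⁻¹' {p | Contains p (plug (dual m φ) b)} :=
    Set.ext fun p => contains_conjugateType b p φ
  rw [← solutionSet_plug, ← borelMeasure_real_contains, measureReal_def, measureReal_def,
    conjugatePush, Measure.map_apply (continuous_conjugateType m b).measurable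
      (isClopen_contains φ).isClosed.measurableSet,
    (MeasurableEmbedding.subtype_coe hS).comap_apply, hpre,
    Subtype.image_preimage_coe, Set.inter_comm,
    measure_inter_conull ((prob_compl_eq_zero_iff hS).2 hν)]

theorem ConcentratesOn.conjugatePush_eq_of_sameType (hν : ConcentratesOn (tuple m) ν)
    {κ : Cardinal.{w}} {β : Type w} (hβ : #β < κ) (hinv : IsInvariantOver κ M ν) {b b' : β → C}
    (h : SameType L (M : Set C) b b') : conjugatePush m b ν = conjugatePush m b' ν := by
  have := hν.isProbabilityMeasure_conjugatePush b
  have := hν.isProbabilityMeasure_conjugatePush b'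
  refine regular_measure_ext_clopens fun U hU => ?_
  obtain ⟨φ, rfl⟩ := exists_setOf_contains_eq hU
  rw [← measureReal_eq_measureReal_iff, hν.conjugatePush_real_contains,
    hν.conjugatePush_real_contains, hinv β hβ _ _ _ h]

end ConjugatePush

section IntrinsicConvolution

variable {L : FirstOrder.Language.{u, v}} {C : Type w} [L.Structure C]

/-- The measure `ρ` is the convolution product of `μ` and `ν`, expressed without a larger monster
model and tested on tuples of all lengths `< κ` instead of just those of length `ι`. -/
def IsIntrinsicConvolution [Nonempty C] (κ : Cardinal.{w}) {M : L.ElementarySubstructure C}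
    {ι : Type w} (m : ι ≃ M) (μ ν ρ : GlobalMeasure L C ι) : Prop :=
  ∀ β : Type w, #β < κ → ∀ (φ : L.Formula (β ⊕ ι)) (b : β → C),
    ρ (fiber φ b) = morleyProduct M μ (conjugatePush m b ν) φ

variable [Infinite C] {κ : Cardinal.{w}} {M : L.ElementarySubstructure C} {ι : Type w} {m : ι ≃ M}
  {μ ν lam ρ σ τ : GlobalMeasure L C ι}

theorem exists_isIntrinsicConvolution (hC : IsSaturated L C κ) (hM : #M < κ)
    (hμ : IsBorelDefinable κ M μ) (hν : ConcentratesOn (tuple m) ν) :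
    ∃ ρ, IsIntrinsicConvolution κ m μ ν ρ := by
  have hι : #ι < κ := (mk_congr m).trans_lt hM
  have : Infinite ι := m.infinite_iff.2 (infinite_elementarySubstructure M)
  have := hν.isProbabilityMeasure_comap
  choose ρ hρ using fun p => exists_conjugateMeasure (m := m) hC hM hμ.invariant p
  have hmeas (X) : Measurable fun p => ρ p X := by
    obtain ⟨φ, b, rfl⟩ := exists_fiber_eq (β := ι) X
    simp only [hρ _ ι hι]
    exact (hμ.measurable ι hι φ).comp (continuous_conjugateType m b).measurable
  refine ⟨.average ρ hmeas ((borelMeasure ν).comap Subtype.val), fun β hβ φ b => ?_⟩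
  rw [morleyProduct, conjugatePush, integral_map (continuous_conjugateType m b).aemeasurable
    (hμ.measurable β hβ φ).aestronglyMeasurable]
  exact integral_congr_ae (.of_forall fun p => hρ p β hβ φ b)

theorem IsIntrinsicConvolution.isInvariantOver (h : IsIntrinsicConvolution κ m μ ν ρ)
    (hνm : ConcentratesOn (tuple m) ν) (hν : IsInvariantOver κ M ν) : IsInvariantOver κ M ρ :=
  fun β hβ φ b b' hb => by
    rw [h β hβ, h β hβ, hνm.conjugatePush_eq_of_sameType hβ hν hb]

theorem IsIntrinsicConvolution.concentratesOn (h : IsIntrinsicConvolution κ m μ ν ρ)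
    (hι : #ι < κ) (hμ : ConcentratesOn (tuple m) μ) (hν : ConcentratesOn (tuple m) ν) :
    ConcentratesOn (tuple m) ρ := by
  refine concentratesOn_iff.2 fun φ hφ => ?_
  have := hν.isProbabilityMeasure_conjugatePush (tuple m)
  rw [← fiber_relabel_inr φ (tuple m), h ι hι, morleyProduct]
  simp only [fiberMap, fiber_relabel_inr, concentratesOn_iff.1 hμ φ hφ]
  simp

theorem IsInvariantOver.conjugatePush_real_contains (hν : IsInvariantOver κ M ν)
    (hνm : ConcentratesOn (tuple m) ν) {β : Type w} (hβ : #β < κ) {b : β → C}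
    {q : TypeSpace L C (M : Set C) β} (hb : Realizes id b q)
    (φ : L.Formula ((M : Set C) ⊕ β)) :
    (conjugatePush m b ν).real {q | Contains q φ} = fiberMap M ν (dual m φ) q := by
  rw [hνm.conjugatePush_real_contains, hν.fiberMap_eq hβ _ hb]

theorem IsBorelDefinable.measurable_conjugatePush_real (hν : IsBorelDefinable κ M ν)
    (hνm : ConcentratesOn (tuple m) ν) {β : Type w} (hβ : #β < κ)
    {c : TypeSpace L C (M : Set C) β → β → C} (hc : ∀ q, Realizes id (c q) q)
    {U : Set (TypeSpace L C (M : Set C) β)} (hU : IsClopen U) :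
    Measurable fun q => (conjugatePush m (c q) ν).real U := by
  obtain ⟨φ, rfl⟩ := exists_setOf_contains_eq hU
  simp only [hν.invariant.conjugatePush_real_contains hνm hβ (hc _)]
  exact hν.measurable β hβ _

theorem IsIntrinsicConvolution.conjugatePush_real (h : IsIntrinsicConvolution κ m ν lam τ)
    (hν : IsInvariantOver κ M ν) (hνm : ConcentratesOn (tuple m) ν)
    (hτm : ConcentratesOn (tuple m) τ) {β : Type w} (hβ : #β < κ)
    {c : TypeSpace L C (M : Set C) β → β → C} (hc : ∀ q, Realizes id (c q) q) (b : β → C)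
    {U : Set (TypeSpace L C (M : Set C) β)} (hU : IsClopen U) :
    (conjugatePush m b τ).real U =
      ∫ q, (conjugatePush m (c q) ν).real U ∂conjugatePush m b lam := by
  obtain ⟨φ, rfl⟩ := exists_setOf_contains_eq hU
  simp only [hν.conjugatePush_real_contains hνm hβ (hc _)]
  rw [hτm.conjugatePush_real_contains, h β hβ, morleyProduct]

theorem IsIntrinsicConvolution.fiberMap_eq_integral (h : IsIntrinsicConvolution κ m μ ν ρ)
    (hνm : ConcentratesOn (tuple m) ν) (hν : IsInvariantOver κ M ν) {β : Type w} (hβ : #β < κ)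
    (φ : L.Formula (β ⊕ ι)) {b : β → C} {q : TypeSpace L C (M : Set C) β}
    (hb : Realizes id b q) :
    fiberMap M ρ φ q = ∫ r, fiberMap M μ φ r ∂conjugatePush m b ν :=
  ((h.isInvariantOver hνm hν).fiberMap_eq hβ φ hb).trans (h β hβ φ b)

theorem IsIntrinsicConvolution.isBorelDefinable (h : IsIntrinsicConvolution κ m μ ν ρ)
    (hC : IsSaturated L C κ) (hM : #M < κ) (hμ : IsDefinable κ M μ)
    (hν : IsBorelDefinable κ M ν) (hνm : ConcentratesOn (tuple m) ν) :
    IsBorelDefinable κ M ρ where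
  invariant := h.isInvariantOver hνm hν.invariant
  measurable β hβ φ := by
    choose c hc using hC.exists_realizes_of_mk_lt (M := M) hM hβ
    have := fun q => hνm.isProbabilityMeasure_conjugatePush (c q)
    have hF : fiberMap M ρ φ = fun q => ∫ r, fiberMap M μ φ r ∂conjugatePush m (c q) ν :=
      funext fun q => h.fiberMap_eq_integral hνm hν.invariant hβ φ (hc q)
    rw [hF]
    exact measurable_integral_of_clopens
      (fun U => hν.measurable_conjugatePush_real hνm hβ hc (U := U))
      ⟨fiberMap M μ φ, hμ.continuous β hβ φ⟩

theorem IsIntrinsicConvolution.assoc (hσ : IsIntrinsicConvolution κ m μ ν σ)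
    (hτ : IsIntrinsicConvolution κ m ν lam τ) (hρ : IsIntrinsicConvolution κ m σ lam ρ)
    (hC : IsSaturated L C κ) (hM : #M < κ) (hμ : IsDefinable κ M μ)
    (hν : IsBorelDefinable κ M ν) (hνm : ConcentratesOn (tuple m) ν)
    (hlam : ConcentratesOn (tuple m) lam) : IsIntrinsicConvolution κ m μ τ ρ := by
  intro β hβ φ b
  choose c hc using hC.exists_realizes_of_mk_lt (M := M) hM hβ
  have := fun q => hνm.isProbabilityMeasure_conjugatePush (c q)
  have := hlam.isProbabilityMeasure_conjugatePush b
  have hτm := hτ.concentratesOn ((mk_congr m).trans_lt hM) hνm hlam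
  have := hτm.isProbabilityMeasure_conjugatePush b
  calc ρ (fiber φ b)
    _ = ∫ q, fiberMap M σ φ q ∂conjugatePush m b lam := hρ β hβ φ b
    _ = ∫ q, ∫ r, fiberMap M μ φ r ∂conjugatePush m (c q) ν ∂conjugatePush m b lam := by
      simp only [hσ.fiberMap_eq_integral hνm hν.invariant hβ φ (hc _)]
    _ = ∫ r, fiberMap M μ φ r ∂conjugatePush m b τ :=
      (integral_eq_integral_integral_of_clopens
        (fun U => hν.measurable_conjugatePush_real hνm hβ hc (U := U))
        (fun U => hτ.conjugatePush_real hν.invariant hνm hτm hβ hc b (U := U))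
        ⟨fiberMap M μ φ, hμ.continuous β hβ φ⟩).symm

end IntrinsicConvolution

section StarProduct

variable {L : FirstOrder.Language.{u, v}} {C : Type w} [L.Structure C] [Infinite C]
  {κ : Cardinal.{w}} {C' : Type w'} [L.Structure C'] {κ' : Cardinal.{w'}} {j : C ↪ₑ[L] C'}
  {M : L.ElementarySubstructure C} {ι : Type w} {m : ι ≃ M} {μ ν ρ ρ' : GlobalMeasure L C ι}

theorem IsConvolution.unique (h : IsConvolution j m μ ν ρ) (h' : IsConvolution j m μ ν ρ') :
    ρ = ρ' := by
  have : Infinite ι := m.infinite_iff.2 (infinite_elementarySubstructure M)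
  refine KeislerMeasure.ext fun X => ?_
  obtain ⟨φ, b, rfl⟩ := exists_fiber_eq (β := ι) X
  rw [h, h']

theorem IsIntrinsicConvolution.isConvolution (h : IsIntrinsicConvolution κ m μ ν ρ)
    (hC' : IsMonster L C' κ') (hj : #(Set.range j) < κ') (hι : #ι < κ) :
    IsConvolution j m μ ν ρ := fun b φ => by
  rw [h ι hι, hPush, hMap_eq_conjugateType hC' hj, conjugatePush]

theorem isIntrinsicConvolution_starProduct (hC : IsSaturated L C κ) (hC' : IsMonster L C' κ')
    (hj : #(Set.range j) < κ') (hM : #M < κ) (hμ : IsBorelDefinable κ M μ)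
    (hν : ConcentratesOn (tuple m) ν) :
    IsIntrinsicConvolution κ m μ ν (starProduct j m μ ν) := by
  obtain ⟨ρ, hρ⟩ := exists_isIntrinsicConvolution hC hM hμ hν
  have h := hρ.isConvolution hC' hj ((mk_congr m).trans_lt hM)
  have hstar : IsConvolution j m μ ν (starProduct j m μ ν) := Classical.epsilon_spec ⟨ρ, h⟩
  exact h.unique hstar ▸ hρ

end StarProduct

end KeislerConvolution

theorem mainTheorem7_general {L : FirstOrder.Language.{u, v}}
    {C : Type w} [L.Structure C] [Infinite C] (κ : Cardinal.{w}) (hC : IsSaturated L C κ)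
    {C' : Type w'} [L.Structure C'] (κ' : Cardinal.{w'}) (hC' : IsMonster L C' κ')
    (j : C ↪ₑ[L] C') (hj : #(Set.range j) < κ')
    (M : L.ElementarySubstructure C) (hM : #M < κ) {ι : Type w} (m : ι ≃ M)
    (μ ν lam : GlobalMeasure L C ι)
    (hμ : IsDefinable κ M μ)
    (hν : IsBorelDefinable κ M ν) (hνm : ConcentratesOn (tuple m) ν)
    (hlam : IsInvariantOver κ M lam) (hlamm : ConcentratesOn (tuple m) lam) :
    (IsConvolution j m μ ν (starProduct j m μ ν) ∧ IsBorelDefinable κ M (starProduct j m μ ν)) ∧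
    (IsConvolution j m ν lam (starProduct j m ν lam) ∧
      IsInvariantOver κ M (starProduct j m ν lam) ∧
      ConcentratesOn (tuple m) (starProduct j m ν lam)) ∧
    IsConvolution j m (starProduct j m μ ν) lam (starProduct j m (starProduct j m μ ν) lam) ∧
    IsConvolution j m μ (starProduct j m ν lam) (starProduct j m μ (starProduct j m ν lam)) ∧
    starProduct j m (starProduct j m μ ν) lam = starProduct j m μ (starProduct j m ν lam) := by
  have hι : #ι < κ := (mk_congr m).trans_lt hM
  have hμν := isIntrinsicConvolution_starProduct hC hC' hj hM hμ.isBorelDefinable hνm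
  have hνlam := isIntrinsicConvolution_starProduct hC hC' hj hM hν hlamm
  have hμνB := hμν.isBorelDefinable hC hM hμ hν hνm
  have hνlamm := hνlam.concentratesOn hι hνm hlamm
  have hleft := isIntrinsicConvolution_starProduct hC hC' hj hM hμνB hlamm
  have hright :=
    (isIntrinsicConvolution_starProduct hC hC' hj hM hμ.isBorelDefinable hνlamm).isConvolution
      hC' hj hι
  exact ⟨⟨hμν.isConvolution hC' hj hι, hμνB⟩,
    ⟨hνlam.isConvolution hC' hj hι, hνlam.isInvariantOver hlamm hlam, hνlamm⟩,
    hleft.isConvolution hC' hj hι, hright,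
    ((hμν.assoc hνlam hleft hC hM hμ hν hνm hlamm).isConvolution hC' hj hι).unique hright⟩

theorem mainTheorem7 {L : FirstOrder.Language.{u, v}}
    -- the monster model `C`, with infinite complete theory
    {C : Type w} [L.Structure C] [Infinite C] (κ : Cardinal.{w}) (hC : IsMonster L C κ)
    -- a larger monster model `C' ≽ C` in which `C` is small
    {C' : Type w'} [L.Structure C'] (κ' : Cardinal.{w'}) (hC' : IsMonster L C' κ')
    (j : C ↪ₑ[L] C') (hj : #(Set.range j) < κ')
    -- a small model `M ≼ C` and an enumeration `m` of it
    (M : L.ElementarySubstructure C) (hM : #M < κ) {ι : Type w} (m : ι ≃ M)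
    (μ ν lam : GlobalMeasure L C ι)
    (hμ : IsDefinable κ M μ)
    (hν : IsBorelDefinable κ M ν) (hνm : ConcentratesOn (tuple m) ν)
    (hlam : IsInvariantOver κ M lam) (hlamm : ConcentratesOn (tuple m) lam) :
    -- the products that occur are defined
    (IsConvolution j m μ ν (starProduct j m μ ν) ∧ IsBorelDefinable κ M (starProduct j m μ ν)) ∧
    (IsConvolution j m ν lam (starProduct j m ν lam) ∧
      IsInvariantOver κ M (starProduct j m ν lam) ∧
      ConcentratesOn (tuple m) (starProduct j m ν lam)) ∧
    IsConvolution j m (starProduct j m μ ν) lam (starProduct j m (starProduct j m μ ν) lam) ∧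
    IsConvolution j m μ (starProduct j m ν lam) (starProduct j m μ (starProduct j m ν lam)) ∧
    -- associativity
    starProduct j m (starProduct j m μ ν) lam = starProduct j m μ (starProduct j m ν lam) :=
  mainTheorem7_general κ hC.saturated κ' hC' j hj M hM m μ ν lam hμ hν hνm hlam hlamm
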